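/- A merge tree $T^h$ is a finite rooted tree $T$ with real heights on its vertices that strictly decrease from the root to the leaves; its underlying space $|T|$ is the union of the edges together with a ray that goes up from the root to height $+\infty$, and $h:|T|\to\mathbb R$ is the induced height function, with $|T|$ topologized by $d(x,y)=h(\mathrm{NCA}(x,y))-\min(h(x),h(y))$. Write $x\preceq y$ if $y=x$ or $y$ is an ancestor of $x$, and $x^{\delta}$ for the ancestor of $x$ at height $h(x)+\delta$. The interleaving distance $d_{ID}(T_1^f,T_2^g)$ is the infimum of all $\varepsilon\ge 0$ for which there are continuous maps $\alpha:|T_1|\to|T_2|$, $\beta:|T_2|\to|T_1|$ with $g(\alpha(u))=f(u)+\varepsilon$, $\beta(\alpha(u))=u^{2\varepsilon}$, $f(\beta(w))=g(w)+\varepsilon$, $\alpha(\beta(w))=w^{2\varepsilon}$ for all $u\in|T_1|$, $w\in|T_2|$. For a map $\alpha:|T_1|\to|T_2|$ and $w\notin\mathrm{Img}(\alpha)$ let $w^A$ be the nearest ancestor of $w$ in $\mathrm{Img}(\alpha)$. A continuous map $\alpha$ is $\varepsilon$-good if $g(\alpha(u))=f(u)+\varepsilon$ for all $u$; $\alpha(u_1)\preceq\alpha(u_2)$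 implies $u_1^{2\varepsilon}\preceq u_2^{2\varepsilon}$; and for every $w\notin\mathrm{Img}(\alpha)$ the point $w^A$ exists and $g(w^A)-g(w)\le 2\varepsilon$. The mean tree construction for $T_1^f$, $T_2^g$ and $\varepsilon$ is the following. (I) Choose an $\varepsilon$-good map $\alpha:|T_1|\to|T_2|$, and let $\hat T_1$ be $T_1$ augmented by all points whose height is the height of a vertex of $T_1$, or the height of a vertex of $T_2$ minus $\varepsilon$. (II) Start with $|T_1|$ and put $k=f+\varepsilon/2$ on it. (III) Let $A=\{w^A : w\in|T_2|\setminus\mathrm{Img}(\alpha)\}$. For each $a\in A$ take the subtree formed by $a$ and all $w\notin\mathrm{Img}(\alpha)$ with $w^A=a$, remove its points $w$ with $g(w)<g(a)-\varepsilon$, and glue the root $a$ of the rest to one chosen point of $\alpha^{-1}(a)$ (for instance the first in a fixed order); put $k=g-\varepsilon/2$ on it. (IV) For all vertices $u_1,u_2$ of $\hat T_1$ with $\alpha(u_1)=\alpha(u_2)$, identify points of equal height on the upward paths from $u_1^{\varepsilon}$ and from $u_2^{\varepsilon}$ (so that the nearest common ancestor of $u_1$ and $u_2$ comes to lie at most $\varepsilon$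 above them). Let $T_3^k$ be the resulting quotient space with the induced function $k$. **Theorem.** Let $T_1^f$, $T_2^g$ be merge trees and $\varepsilon\ge 0$ with $d_{ID}(T_1^f,T_2^g)\le\varepsilon$. Then an $\varepsilon$-good map $\alpha:|T_1|\to|T_2|$ exists, so the construction can be carried out; and for every choice of $\alpha$ and of the gluing points in (III), the result $T_3^k$ is a merge tree (it is homeomorphic, by a homeomorphism preserving heights, to the underlying space of a merge tree), and $$d_{ID}(T_1^f,T_3^k)\le\frac{\varepsilon}{2},\qquad d_{ID}(T_2^g,T_3^k)\le\frac{\varepsilon}{2}.$$ -/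

import Mathlib

open scoped NNReal ENNReal

universe u

/-- A (finite) merge tree: a finite rooted tree whose vertices carry real heights that strictly
decrease from the root towards the leaves. In `RootedTree` the root is `⊥`, `Order.pred v` is the
parent of `v`, and `w ≤ v` says that `w` is `v` or an ancestor of `v`. As usual for merge trees, the
root also carries an edge going up to height `+∞`; see `MergeTree.Pt`. -/
structure MergeTree : Type (u + 1) where
  tree : RootedTree.{u}
  [finite : Finite tree]
  height : tree → ℝ
  strictAnti : StrictAnti height

namespace MergeTree

/-- The points of the underlying space `|T|`. The point `(v, t)` is the point at height `t` on the
half-open edge from the vertex `v` (included) to its parent (excluded); if `v` is the root, the edge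
is the ray going up to `+∞`. -/
@[ext]
structure Pt (T : MergeTree.{u}) : Type u where
  vertex : T.tree
  level : ℝ
  le_level : T.height vertex ≤ level
  level_lt : vertex ≠ ⊥ → level < T.height (Order.pred vertex)

variable {T : MergeTree.{u}}

/-- The ancestor order on `|T|`: `x ≤ y` if `y` is equal to `x` or an ancestor of `x`. -/
instance : PartialOrder T.Pt where
  le x y := y.vertex ≤ x.vertex ∧ x.level ≤ y.level
  le_refl x := ⟨le_rfl, le_rfl⟩
  le_trans _ _ _ h h' := ⟨h'.1.trans h.1, h.2.trans h'.2⟩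
  le_antisymm _ _ h h' := Pt.ext (le_antisymm h'.1 h.1) (le_antisymm h.2 h'.2)

theorem Pt.le_def {x y : T.Pt} : x ≤ y ↔ y.vertex ≤ x.vertex ∧ x.level ≤ y.level := Iff.rfl

/-- Every height above that of a vertex `v` is attained on the path from `v` upwards. -/
theorem exists_ancestor (T : MergeTree.{u}) (v : T.tree) (t : ℝ) (h : T.height v ≤ t) :
    ∃ x : T.Pt, x.vertex ≤ v ∧ x.level = t := by
  have := T.finite
  obtain ⟨w, hw, hmin⟩ := (Set.toFinite {w : T.tree | w ≤ v ∧ T.height w ≤ t}).exists_minimal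
    ⟨v, le_rfl, h⟩
  refine ⟨⟨w, t, hw.2, fun hne => ?_⟩, hw.1, rfl⟩
  by_contra hlt
  have hp : Order.pred w < w := Order.pred_lt_of_not_isMin (by rwa [isMin_iff_eq_bot])
  exact absurd (hmin ⟨(Order.pred_le w).trans hw.1, not_lt.mp hlt⟩ hp.le) hp.not_ge

/-- Two points whose edges lie on a common downward path are ordered as their heights are. -/
theorem Pt.le_of_vertex_le {x y : T.Pt} {v : T.tree} (hx : x.vertex ≤ v) (hy : y.vertex ≤ v)
    (h : x.level ≤ y.level) : x ≤ y := by
  refine ⟨?_, h⟩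
  rcases le_total_of_directed hx hy with h' | h'
  · exact h'
  · rcases h'.eq_or_lt with h'' | h''
    · exact h''.ge
    · exfalso
      have h1 := y.level_lt (bot_le.trans_lt h'').ne'
      have h2 := T.strictAnti.antitone (Order.le_pred_of_lt h'')
      linarith [x.le_level]

/-- The ancestor of `v` at height `t`. -/
noncomputable def ancestor (T : MergeTree.{u}) (v : T.tree) (t : ℝ) (h : T.height v ≤ t) : T.Pt :=
  (T.exists_ancestor v t h).choose

theorem ancestor_vertex_le (v : T.tree) (t : ℝ) (h : T.height v ≤ t) :
    (T.ancestor v t h).vertex ≤ v := (T.exists_ancestor v t h).choose_spec.1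

theorem ancestor_level (v : T.tree) (t : ℝ) (h : T.height v ≤ t) :
    (T.ancestor v t h).level = t := (T.exists_ancestor v t h).choose_spec.2

/-- `x ⊔ y` is the nearest common ancestor of `x` and `y`. -/
noncomputable instance : SemilatticeSup T.Pt where
  sup x y := T.ancestor (x.vertex ⊓ y.vertex)
    (max (T.height (x.vertex ⊓ y.vertex)) (max x.level y.level)) (le_max_left _ _)
  le_sup_left x y := ⟨(ancestor_vertex_le _ _ _).trans inf_le_left, by
    rw [ancestor_level]; exact (le_max_left _ _).trans (le_max_right _ _)⟩
  le_sup_right x y := ⟨(ancestor_vertex_le _ _ _).trans inf_le_right, by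
    rw [ancestor_level]; exact (le_max_right _ _).trans (le_max_right _ _)⟩
  sup_le x y z hx hy := by
    refine Pt.le_of_vertex_le (ancestor_vertex_le _ _ _) (le_inf hx.1 hy.1) ?_
    rw [ancestor_level]
    exact max_le ((T.strictAnti.antitone (le_inf hx.1 hy.1)).trans z.le_level) (max_le hx.2 hy.2)

/-- The path metric `d(x, y) = h(NCA(x, y)) - min (h x) (h y)` (the maximum minus the minimum of the
height along the path from `x` to `y`). It induces the usual topology of `|T|`. -/
noncomputable instance : MetricSpace T.Pt where
  dist x y := (x ⊔ y).level - min x.level y.level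
  dist_self x := by simp
  dist_comm x y := by rw [sup_comm, min_comm]
  dist_triangle x y z := by
    have hxy : x ≤ x ⊔ y := le_sup_left
    have hyx : y ≤ x ⊔ y := le_sup_right
    have hyz : y ≤ y ⊔ z := le_sup_left
    have hzy : z ≤ y ⊔ z := le_sup_right
    have key : (x ⊔ z).level ≤ max (x ⊔ y).level (y ⊔ z).level := by
      rcases le_total (x ⊔ y).level (y ⊔ z).level with h | h
      · have h' := Pt.le_of_vertex_le hyx.1 hyz.1 h
        exact (sup_le (hxy.trans h') hzy).2.trans (le_max_right _ _)
      · have h' := Pt.le_of_vertex_le hyz.1 hyx.1 h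
        exact (sup_le hxy (hzy.trans h')).2.trans (le_max_left _ _)
    have h1 := hxy.2
    have h2 := hyx.2
    have h3 := hyz.2
    have h4 := hzy.2
    rcases max_choice (x ⊔ y).level (y ⊔ z).level with hm | hm <;>
      rcases min_choice x.level z.level with hn | hn <;> rw [hm] at key <;> rw [hn] <;>
      linarith [min_le_left x.level y.level, min_le_right x.level y.level,
        min_le_left y.level z.level, min_le_right y.level z.level]
  eq_of_dist_eq_zero {x y} h := by
    have hx : x ≤ x ⊔ y := le_sup_left
    have hy : y ≤ x ⊔ y := le_sup_right
    have h' : (x ⊔ y).level = min x.level y.level := sub_eq_zero.mp h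
    have e1 : x.level = (x ⊔ y).level :=
      le_antisymm hx.2 (by rw [h']; exact min_le_left _ _)
    have e2 : y.level = (x ⊔ y).level :=
      le_antisymm hy.2 (by rw [h']; exact min_le_right _ _)
    exact (le_antisymm hx (Pt.le_of_vertex_le hx.1 le_rfl e1.ge)).trans
      (le_antisymm hy (Pt.le_of_vertex_le hy.1 le_rfl e2.ge)).symm

/-- `x.up δ` is the point usually written `x ^ δ`: the ancestor of `x` at height `h x + δ`. -/
noncomputable def Pt.up (x : T.Pt) (δ : ℝ≥0) : T.Pt :=
  T.ancestor x.vertex (x.level + δ) (x.le_level.trans (le_add_of_nonneg_right δ.2))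

theorem Pt.le_up (x : T.Pt) (δ : ℝ≥0) : x ≤ x.up δ :=
  ⟨ancestor_vertex_le _ _ _, by
    unfold Pt.up; rw [ancestor_level]; exact le_add_of_nonneg_right δ.2⟩

theorem Pt.up_level (x : T.Pt) (δ : ℝ≥0) : (x.up δ).level = x.level + δ := ancestor_level _ _ _

/-- `x.up δ` is the only ancestor of `x` at height `h x + δ`. -/
theorem Pt.eq_up {x y : T.Pt} {δ : ℝ≥0} (hxy : x ≤ y) (h : y.level = x.level + δ) :
    y = x.up δ :=
  le_antisymm (Pt.le_of_vertex_le hxy.1 (x.le_up δ).1 (by rw [h, Pt.up_level]))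
    (Pt.le_of_vertex_le (x.le_up δ).1 hxy.1 (by rw [h, Pt.up_level]))

/-- The continuous maps `α : |T₁| → |T₂|` and `β : |T₂| → |T₁|` are `ε`-interleaved. -/
structure IsInterleaving (T₁ T₂ : MergeTree.{u}) (ε : ℝ≥0) (α : T₁.Pt → T₂.Pt)
    (β : T₂.Pt → T₁.Pt) : Prop where
  continuous_left : Continuous α
  continuous_right : Continuous β
  level_left : ∀ u, (α u).level = u.level + ε
  right_left : ∀ u, β (α u) = u.up (2 * ε)
  level_right : ∀ w, (β w).level = w.level + ε
  left_right : ∀ w, α (β w) = w.up (2 * ε)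

/-- The interleaving distance: the infimum of all `ε ≥ 0` for which there are `ε`-interleaved maps,
computed in `[0, ∞]`. -/
noncomputable def interleavingDist (T₁ T₂ : MergeTree.{u}) : ℝ≥0∞ :=
  ⨅ (ε : ℝ≥0) (_ : ∃ α β, IsInterleaving T₁ T₂ ε α β), (ε : ℝ≥0∞)

/-- `a` is the nearest ancestor `w^A` of `w` in the image of `α`. -/
def IsNearest {T₁ T₂ : MergeTree.{u}} (α : T₁.Pt → T₂.Pt) (w a : T₂.Pt) : Prop :=
  IsLeast {b | b ∈ Set.range α ∧ w ≤ b} a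

/-- `ε`-good maps from `|T₁|` to `|T₂|`. -/
structure IsGoodMap (T₁ T₂ : MergeTree.{u}) (ε : ℝ≥0) (α : T₁.Pt → T₂.Pt) : Prop where
  continuous : Continuous α
  level : ∀ u, (α u).level = u.level + ε
  le_of_le : ∀ u₁ u₂, α u₁ ≤ α u₂ → u₁.up (2 * ε) ≤ u₂.up (2 * ε)
  nearest : ∀ w, w ∉ Set.range α → ∃ a, IsNearest α w a ∧ a.level - w.level ≤ 2 * ε

/-- The vertices of the augmentation of `T₁` (with respect to `T₂` and `ε`): `T₁` is cut at all
heights of its own vertices and at all heights of vertices of `T₂` lowered by `ε`. -/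
def augmentedVertices (T₁ T₂ : MergeTree.{u}) (ε : ℝ≥0) : Set T₁.Pt :=
  {p | (∃ v, T₁.height v = p.level) ∨ ∃ w, T₂.height w - ε = p.level}

/-- The choices made in the mean tree construction: an `ε`-good map `α`, and for every point `a` of
`|T₂|` that is the nearest ancestor in the image of `α` of some point outside this image, a preimage
of `a` at which the trimmed subtrees below `a` are attached (the first one in the chosen order). -/
structure MeanTreeData (T₁ T₂ : MergeTree.{u}) (ε : ℝ≥0) where
  α : T₁.Pt → T₂.Pt
  good : IsGoodMap T₁ T₂ ε α
  attach : T₂.Pt → T₁.Pt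
  α_attach : ∀ w a, w ∉ Set.range α → IsNearest α w a → α (attach a) = a

namespace MeanTreeData

variable {T₁ T₂ : MergeTree.{u}} {ε : ℝ≥0} (D : MeanTreeData T₁ T₂ ε)

/-- The roots `w^A` of the subtrees of `T₂` lying outside the image of `α`. -/
def roots : Set T₂.Pt := {a | ∃ w, w ∉ Set.range D.α ∧ IsNearest D.α w a}

/-- The union of the trimmed subtrees: the roots, and the points `w` outside the image of `α` that
are at most `ε` below their root. -/
def trimmed : Set T₂.Pt :=
  D.roots ∪ {w | w ∉ Set.range D.α ∧ ∃ a, IsNearest D.α w a ∧ a.level - ε ≤ w.level}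

/-- The identifications that produce the mean tree from the disjoint union of `|T₁|` and the trimmed
subtrees. `attach` glues the root `a` of the subtrees below `a` to the chosen preimage of `a`.
`merge` treats vertices `u₁`, `u₂` of the augmented tree with the same image: the paths going up from
`u₁` and `u₂` are identified from height `ε` above `u₁`, `u₂` on, so that their nearest common
ancestor is lowered to this height unless it was below already. -/
inductive Glue : T₁.Pt ⊕ D.trimmed → T₁.Pt ⊕ D.trimmed → Prop
  | attach (a : T₂.Pt) (ha : a ∈ D.roots) : Glue (.inl (D.attach a)) (.inr ⟨a, Or.inl ha⟩)
  | merge (u₁ u₂ p₁ p₂ : T₁.Pt) (hu₁ : u₁ ∈ augmentedVertices T₁ T₂ ε)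
      (hu₂ : u₂ ∈ augmentedVertices T₁ T₂ ε) (hα : D.α u₁ = D.α u₂) (h₁ : u₁ ≤ p₁) (h₂ : u₂ ≤ p₂)
      (hp : p₁.level = p₂.level) (hε : u₁.level + ε ≤ p₁.level) : Glue (.inl p₁) (.inl p₂)

/-- The underlying space of the mean tree, with the quotient topology. -/
def Mean : Type u := Quot D.Glue

instance : TopologicalSpace D.Mean := inferInstanceAs (TopologicalSpace (Quot D.Glue))

/-- The function `k` on the mean tree: `f + ε / 2` on `|T₁|`, and `g - ε / 2` on the trimmed
subtrees of `T₂`. -/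
noncomputable def k : D.Mean → ℝ :=
  Quot.lift (Sum.elim (fun p => p.level + ε / 2) fun w => w.1.level - ε / 2) <| by
    rintro _ _ (⟨a, ha⟩ | ⟨u₁, u₂, p₁, p₂, -, -, -, -, -, hp, -⟩)
    · obtain ⟨w, hw, hwa⟩ := ha
      have h := D.good.level (D.attach a)
      rw [D.α_attach w a hw hwa] at h
      simp only [Sum.elim_inl, Sum.elim_inr]
      linarith
    · simp [hp]

end MeanTreeData

end MergeTree

/-! A map between merge trees that shifts all heights by one constant is continuous exactly when it
is monotone for the ancestor order (`Pt.continuous_of_monotone`, `Pt.monotone_of_continuous`).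
Topology thus turns into order theory: two monotone `ε`-shifts are interleaved as soon as both
compositions send points to ancestors (`IsInterleaving.of_monotone`).

A good map exists because the infimum is attained (`exists_isInterleaving`). There are only finitely
many differences of vertex heights, so for `δ` slightly above `ε` a `δ`-interleaving can be pushed
down to an `ε`-interleaving without meeting a vertex; its left map is good.

The quotient is a merge tree because every point has one ancestor at each greater height, any two
points have a common ancestor, and branching happens only at finitely many critical heights.
`LevelledTree` axiomatizes such data and builds the finite tree from the points at critical heights.
The substantial axiom is `eq_of_raise_eq`: the identifications create no branching between critical
heights.

The distance bounds come from four explicit `ε / 2`-shifts. For `T₁` they are the inclusion `mk₁`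
and `toLeft`, which climbs by `ε` in `T₁` and sends a trimmed point `w` to the ancestor at height
`g(w)` of the attaching point. This ancestor exists because trimming keeps only depth `ε`, and
merged points agree because goodness gives `u₁^{2ε} = u₂^{2ε}`. For `T₂` they are `toRight`, given
by `α` and the inclusion of the subtrees, and `ofRight`, which picks a preimage under `α`, or the
lowest untrimmed ancestor, and climbs. The choice of preimage disappears because preimages merge
within `ε`, and the climb is high enough because at most `2ε - ε = ε` is trimmed off. -/

namespace MergeTree

/-! ### Ancestors at given heights, and continuity versus monotonicity -/

namespace Pt

variable {T T' : MergeTree.{u}}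

theorem level_mono {x y : T.Pt} (h : x ≤ y) : x.level ≤ y.level := h.2

theorem le_of_le_of_le {x y z : T.Pt} (hy : x ≤ y) (hz : x ≤ z) (h : y.level ≤ z.level) : y ≤ z :=
  le_of_vertex_le hy.1 hz.1 h

theorem eq_of_le_of_le {x y z : T.Pt} (hy : x ≤ y) (hz : x ≤ z) (h : y.level = z.level) : y = z :=
  le_antisymm (le_of_le_of_le hy hz h.le) (le_of_le_of_le hz hy h.ge)

theorem le_total_of_le {x y z : T.Pt} (hy : x ≤ y) (hz : x ≤ z) : y ≤ z ∨ z ≤ y :=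
  (le_total y.level z.level).imp (le_of_le_of_le hy hz) (le_of_le_of_le hz hy)

/-- The ancestor of `x` at height `t`, or `x` itself if it lies above this height. -/
noncomputable def raise (x : T.Pt) (t : ℝ) : T.Pt :=
  T.ancestor x.vertex (max t x.level) (x.le_level.trans (le_max_right _ _))

theorem le_raise (x : T.Pt) (t : ℝ) : x ≤ x.raise t :=
  ⟨ancestor_vertex_le _ _ _, by unfold raise; rw [ancestor_level]; exact le_max_right _ _⟩

@[simp]
theorem raise_level (x : T.Pt) (t : ℝ) : (x.raise t).level = max t x.level := ancestor_level _ _ _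

theorem raise_level_of_le {x : T.Pt} {t : ℝ} (h : x.level ≤ t) : (x.raise t).level = t := by
  rw [raise_level, max_eq_left h]

theorem raise_eq_of_le {x y : T.Pt} {t : ℝ} (h : x ≤ y) (hy : y.level = max t x.level) :
    x.raise t = y :=
  eq_of_le_of_le (x.le_raise t) h (by rw [raise_level, hy])

theorem raise_level_eq {x y : T.Pt} (h : x ≤ y) : x.raise y.level = y :=
  raise_eq_of_le h (max_eq_left h.2).symm

theorem raise_of_le {x : T.Pt} {t : ℝ} (h : t ≤ x.level) : x.raise t = x :=
  raise_eq_of_le le_rfl (max_eq_right h).symm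

theorem raise_raise (x : T.Pt) (s t : ℝ) : (x.raise s).raise t = x.raise (max s t) :=
  (raise_eq_of_le ((x.le_raise s).trans ((x.raise s).le_raise t)) (by
    rw [raise_level, raise_level, max_left_comm, max_assoc])).symm

theorem raise_le {x y : T.Pt} {t : ℝ} (h : x ≤ y) (ht : t ≤ y.level) : x.raise t ≤ y :=
  le_of_le_of_le (x.le_raise t) h (by rw [raise_level]; exact max_le ht h.2)

theorem exists_raise_eq (x y : T.Pt) : ∃ t, x.raise t = y.raise t :=
  ⟨(x ⊔ y).level, by
    rw [raise_level_eq le_sup_left, raise_level_eq le_sup_right]⟩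

theorem dist_def (x y : T.Pt) : dist x y = (x ⊔ y).level - min x.level y.level := rfl

theorem dist_of_le {x y : T.Pt} (h : x ≤ y) : dist x y = y.level - x.level := by
  rw [dist_def, sup_eq_right.mpr h, min_eq_left h.2]

theorem abs_level_sub_le_dist (x y : T.Pt) : |x.level - y.level| ≤ dist x y := by
  have h1 := level_mono (le_sup_left : x ≤ x ⊔ y)
  have h2 := level_mono (le_sup_right : y ≤ x ⊔ y)
  rw [dist_def, abs_le]
  constructor <;> linarith [min_le_left x.level y.level, min_le_right x.level y.level]

theorem continuous_level : Continuous (level : T.Pt → ℝ) :=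
  (LipschitzWith.mk_one fun x y => by
    rw [Real.dist_eq]; exact abs_level_sub_le_dist x y).continuous

/-- A monotone map that shifts all heights by the same amount is continuous. -/
theorem continuous_of_monotone {f : T.Pt → T'.Pt} {c : ℝ} (hf : Monotone f)
    (hc : ∀ x, (f x).level = x.level + c) : Continuous f :=
  (LipschitzWith.mk_one fun x y => by
    have h := level_mono (sup_le (hf (le_sup_left : x ≤ x ⊔ y)) (hf (le_sup_right : y ≤ x ⊔ y)))
    rw [hc] at h
    rw [dist_def, dist_def, hc, hc, min_add_add_right]
    linarith).continuous

theorem continuous_raise_const (x : T.Pt) : Continuous fun t => x.raise t := by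
  refine (LipschitzWith.mk_one fun s t => ?_).continuous
  wlog h : s ≤ t generalizing s t
  · rw [dist_comm, dist_comm s]; exact this t s (le_of_not_ge h)
  have hle : x.raise s ≤ x.raise t :=
    le_of_le_of_le (x.le_raise s) (x.le_raise t) (by
      rw [raise_level, raise_level]; exact max_le_max_right _ h)
  rw [dist_of_le hle, raise_level, raise_level, dist_comm, Real.dist_eq,
    abs_of_nonneg (sub_nonneg.mpr h)]
  rcases max_cases t x.level with h1 | h1 <;> rcases max_cases s x.level with h2 | h2 <;> linarith

/-- The up-set is the equalizer of two continuous maps: raising `x` to the height of `y`, and the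
identity. -/
theorem isClosed_Ici (x : T.Pt) : IsClosed {y | x ≤ y} := by
  have : {y | x ≤ y} = {y | x.raise y.level = y} := by
    ext y
    exact ⟨raise_level_eq, fun h => (show x.raise y.level = y from h) ▸ x.le_raise _⟩
  rw [this]
  exact isClosed_eq ((continuous_raise_const x).comp continuous_level) continuous_id

theorem level_lt_of_vertex_lt {x y : T.Pt} (h : y.vertex < x.vertex) :
    x.level < y.level := by
  have h1 := x.level_lt (bot_le.trans_lt h).ne'
  have h2 := T.strictAnti.antitone (Order.le_pred_of_lt h)
  linarith [y.le_level]

/-- All points that are sufficiently close to `z` are comparable with `z`. -/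
theorem exists_comparable (z : T.Pt) :
    ∃ r > 0, ∀ y, dist z y < r → z ≤ y ∨ y ≤ z := by
  obtain ⟨r, hr, hr'⟩ : ∃ r > 0, ∀ y : T.Pt, z ≤ y → y.level < z.level + r →
      y.vertex = z.vertex := by
    by_cases hz : z.vertex = ⊥
    · exact ⟨1, one_pos, fun y hy _ => (le_antisymm hy.1 (hz ▸ bot_le))⟩
    · refine ⟨_, sub_pos.mpr (z.level_lt hz), fun y hy h => ?_⟩
      by_contra hne
      have := T.strictAnti.antitone (Order.le_pred_of_lt (lt_of_le_of_ne hy.1 hne))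
      linarith [y.le_level]
  refine ⟨r, hr, fun y hy => ?_⟩
  rw [dist_def] at hy
  have hv := hr' (z ⊔ y) le_sup_left (by linarith [min_le_left z.level y.level])
  have hzy : z.vertex ≤ y.vertex := hv ▸ (le_sup_right : y ≤ z ⊔ y).1
  rcases le_or_gt y.level z.level with h | h
  · exact .inr ⟨hzy, h⟩
  · refine .inl ⟨?_, h.le⟩
    rcases hzy.eq_or_lt with h' | h'
    · exact h'.ge
    · exact absurd (level_lt_of_vertex_lt h') h.not_gt

/-- The point at height `s` on the edge of `x`. -/
def lower (x : T.Pt) (s : ℝ) (h : T.height x.vertex ≤ s) (h' : s ≤ x.level) : T.Pt :=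
  ⟨x.vertex, s, h, fun hne => h'.trans_lt (x.level_lt hne)⟩

theorem lower_le (x : T.Pt) (s : ℝ) (h : T.height x.vertex ≤ s) (h' : s ≤ x.level) :
    x.lower s h h' ≤ x := ⟨le_rfl, h'⟩

/-- The point of the underlying space at a vertex. -/
def ofVertex (v : T.tree) : T.Pt :=
  ⟨v, T.height v, le_rfl, fun hb =>
    T.strictAnti (Order.pred_lt_of_not_isMin (by rwa [isMin_iff_eq_bot]))⟩

theorem vertex_eq_of_le {x z : T.Pt} (hx : x ≤ z) (h : T.height z.vertex ≤ x.level) :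
    x.vertex = z.vertex := by
  by_contra hne
  exact (level_lt_of_vertex_lt (y := ofVertex z.vertex)
    (lt_of_le_of_ne hx.1 (Ne.symm hne))).not_ge h

theorem eq_of_le_of_height_le {x y z : T.Pt} (hx : x ≤ z) (hy : y ≤ z) (hxy : x.level = y.level)
    (h : T.height z.vertex ≤ x.level) : x = y :=
  Pt.ext ((vertex_eq_of_le hx h).trans (vertex_eq_of_le hy (hxy ▸ h)).symm) hxy

/-- Between heights of vertices the tree does not branch. -/
theorem eq_of_le_of_forall_notMem {x y z : T.Pt} (hx : x ≤ z) (hy : y ≤ z)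
    (hxy : x.level = y.level) (h : ∀ v, T.height v ∉ Set.Ioc x.level z.level) : x = y :=
  eq_of_le_of_height_le hx hy hxy (not_lt.mp fun hlt => h z.vertex ⟨hlt, z.le_level⟩)

theorem ofVertex_le (x : T.Pt) : ofVertex x.vertex ≤ x := ⟨le_rfl, x.le_level⟩

/-- There are finitely many points at finitely many heights. -/
theorem finite_level_mem {s : Set ℝ} (hs : s.Finite) : {x : T.Pt | x.level ∈ s}.Finite := by
  have := T.finite
  refine Set.Finite.of_finite_image (f := fun x : T.Pt => (x.vertex, x.level)) ?_
    fun x _ y _ h => Pt.ext (congrArg Prod.fst h) (congrArg Prod.snd h)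
  refine ((Set.finite_univ (α := T.tree)).prod hs).subset ?_
  rintro _ ⟨x, hx, rfl⟩
  exact ⟨trivial, hx⟩

/-- A continuous map that shifts all heights by the same amount is monotone. -/
theorem monotone_of_continuous {f : T.Pt → T'.Pt} {c : ℝ} (hf : Continuous f)
    (hc : ∀ x, (f x).level = x.level + c) : Monotone f := by
  intro x y hxy
  have hγ : Continuous fun t => f (x.raise t) := hf.comp (continuous_raise_const x)
  have hlev : ∀ t, x.level ≤ t → (f (x.raise t)).level = t + c := fun t ht => by
    rw [hc, raise_level_of_le ht]
  -- Real induction along the path from `x` up to `y`. Points near `f (x.raise t)` are comparable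
  -- with it, and among comparable points the higher one is the ancestor, so the relation persists
  -- slightly beyond `t`.
  have hS : Set.Icc x.level y.level ⊆ {t | f x ≤ f (x.raise t)} := by
    refine IsClosed.Icc_subset_of_forall_exists_gt (a := x.level) (b := y.level) ?_ ?_ ?_
    · exact ((isClosed_Ici (f x)).preimage hγ).inter isClosed_Icc
    · rw [Set.mem_ofPred_eq, raise_of_le le_rfl]
    · rintro t ⟨ht, htl, htr⟩ b hb
      obtain ⟨r, hr, hcomp⟩ := exists_comparable (f (x.raise t))
      have hev : ∀ᶠ s in nhds t, dist (f (x.raise t)) (f (x.raise s)) < r := by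
        have := Metric.tendsto_nhds.mp (hγ.continuousAt (x := t)) r hr
        exact this.mono fun s hs => by rwa [dist_comm]
      obtain ⟨s, hs, hs'⟩ := ((hev.filter_mono nhdsWithin_le_nhds).and
        (Ioc_mem_nhdsGT (show t < b from hb))).exists
      refine ⟨s, ?_, hs'⟩
      rcases hcomp _ hs with h | h
      · exact le_trans ht h
      · have h2 := h.2
        rw [hlev t htl, hlev s (htl.trans hs'.1.le)] at h2
        linarith [hs'.1]
  have := hS ⟨hxy.2, le_rfl⟩
  rwa [Set.mem_ofPred_eq, raise_level_eq hxy] at this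

theorem map_raise_of_monotone {f : T.Pt → T'.Pt} {c : ℝ} (hf : Monotone f)
    (hc : ∀ x, (f x).level = x.level + c) (x : T.Pt) (t : ℝ) :
    f (x.raise t) = (f x).raise (t + c) :=
  (raise_eq_of_le (hf (x.le_raise t)) (by
    rw [hc, hc, raise_level, max_add_add_right])).symm

end Pt

end MergeTree

/-! ### Recognizing merge trees from heights and ancestors -/

/-- An abstract description of a merge tree by its points: every point has a level, and a unique
ancestor at each larger level; any two points have a common ancestor; and the tree branches only
at finitely many critical levels. -/
structure LevelledTree (P : Type u) where
  level : P → ℝ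
  raise : P → ℝ → P
  level_raise : ∀ x t, level (raise x t) = max t (level x)
  raise_raise : ∀ x s t, raise (raise x s) t = raise x (max s t)
  raise_of_le : ∀ x t, t ≤ level x → raise x t = x
  exists_raise_eq : ∀ x y, ∃ t, raise x t = raise y t
  critical : Set ℝ
  finite_vertices : {x | level x ∈ critical}.Finite
  exists_floor : ∀ x, ∃ y, level y ∈ critical ∧ raise y (level x) = x ∧
    ∀ s ∈ critical, s ≤ level x → s ≤ level y
  eq_of_raise_eq : ∀ x y t, level x = level y → raise x t = raise y t →
    (∀ s ∈ critical, s ≤ t → s ≤ level x) → x = y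
  nonempty : Nonempty P

namespace LevelledTree

variable {P : Type u} (A : LevelledTree P)

/-- `A.Anc x y` says that `y` is `x` or an ancestor of `x`. -/
def Anc (x y : P) : Prop := A.raise x (A.level y) = y

variable {A}

theorem anc_refl (x : P) : A.Anc x x := A.raise_of_le x _ le_rfl

theorem anc_raise (x : P) (t : ℝ) : A.Anc x (A.raise x t) := by
  unfold Anc
  rw [A.level_raise]
  conv_rhs => rw [← A.raise_of_le x _ le_rfl]
  rw [A.raise_raise, max_comm]

theorem Anc.level_le {x y : P} (h : A.Anc x y) : A.level x ≤ A.level y := by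
  have := A.level_raise x (A.level y)
  rw [h] at this
  exact max_eq_left_iff.mp this.symm

theorem Anc.of_anc {x y z : P} (hy : A.Anc x y) (hz : A.Anc x z) (h : A.level y ≤ A.level z) :
    A.Anc y z := by
  unfold Anc at *
  rw [← hy, A.raise_raise, max_eq_right h, hz]

theorem Anc.trans {x y z : P} (hy : A.Anc x y) (hz : A.Anc y z) : A.Anc x z := by
  have h := hz.level_le
  unfold Anc at *
  rw [← hy, A.raise_raise, max_eq_right h] at hz
  exact hz

theorem Anc.eq {x y : P} (h : A.Anc x y) (hl : A.level y ≤ A.level x) : x = y := by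
  rw [← A.raise_of_le x _ hl]; exact h

variable (A)

/-- The points at critical levels. -/
def Vertex : Type u := {x : P // A.level x ∈ A.critical}

variable {A}

instance : PartialOrder A.Vertex where
  le v w := A.Anc w.1 v.1
  le_refl v := anc_refl v.1
  le_trans _ _ _ h h' := Anc.trans h' h
  le_antisymm _ _ h h' := Subtype.ext (h'.eq h.level_le)

theorem Vertex.le_def {v w : A.Vertex} : v ≤ w ↔ A.Anc w.1 v.1 := Iff.rfl

instance : Finite A.Vertex := A.finite_vertices

theorem Vertex.level_strictAnti : StrictAnti fun v : A.Vertex => A.level v.1 := fun _ _ h =>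
  lt_of_le_of_ne (Vertex.le_def.mp h.le).level_le fun he =>
    h.ne' (Subtype.ext ((Vertex.le_def.mp h.le).eq he.ge))

variable (A)

/-- The highest vertex below a point on its edge. -/
noncomputable def floor (x : P) : A.Vertex :=
  ⟨(A.exists_floor x).choose, (A.exists_floor x).choose_spec.1⟩

variable {A}

theorem anc_floor (x : P) : A.Anc (A.floor x).1 x := (A.exists_floor x).choose_spec.2.1

theorem le_level_floor {x : P} {s : ℝ} (hs : s ∈ A.critical) (h : s ≤ A.level x) :
    s ≤ A.level (A.floor x).1 := (A.exists_floor x).choose_spec.2.2 s hs h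

/-- The ancestor of `v` at the height of the floor and the floor itself have the common ancestor
`x`, with no critical height in between, so they coincide. -/
theorem floor_le {v : A.Vertex} {x : P} (h : A.Anc v.1 x) : A.floor x ≤ v := by
  have h1 := le_level_floor v.2 h.level_le
  have h2 := (anc_floor (A := A) x).level_le
  refine A.eq_of_raise_eq _ _ (A.level x) (by rw [A.level_raise, max_eq_left h1]) ?_ ?_
  · rw [A.raise_raise, max_eq_right h2, h, anc_floor]
  · intro s hs hsx
    rw [A.level_raise, max_eq_left h1]
    exact le_level_floor hs hsx

/-- The set consists of ancestors of the single vertex `v`, hence is a chain, and its lowest member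
is the maximum. -/
theorem Vertex.exists_max {S : Set A.Vertex} (hS : S.Nonempty) {v : A.Vertex}
    (hv : ∀ w ∈ S, w ≤ v) : ∃ m ∈ S, ∀ w ∈ S, w ≤ m := by
  obtain ⟨m, hm, hmin⟩ := Set.exists_min_image S (fun v => A.level v.1) (Set.toFinite S) hS
  exact ⟨m, hm, fun w hw => Anc.of_anc (hv m hm) (hv w hw) (hmin w hw)⟩

theorem Vertex.exists_inf (v w : A.Vertex) :
    ∃ m : A.Vertex, (m ≤ v ∧ m ≤ w) ∧ ∀ c, c ≤ v ∧ c ≤ w → c ≤ m := by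
  refine Vertex.exists_max (S := {m | m ≤ v ∧ m ≤ w}) ?_ fun c hc => hc.1
  obtain ⟨t, h⟩ := A.exists_raise_eq v.1 w.1
  exact ⟨A.floor (A.raise v.1 t), floor_le (anc_raise _ _), floor_le (h ▸ anc_raise _ _)⟩

noncomputable instance : SemilatticeInf A.Vertex where
  inf v w := (Vertex.exists_inf v w).choose
  inf_le_left v w := (Vertex.exists_inf v w).choose_spec.1.1
  inf_le_right v w := (Vertex.exists_inf v w).choose_spec.1.2
  le_inf u v w h h' := (Vertex.exists_inf v w).choose_spec.2 u ⟨h, h'⟩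

instance : Nonempty A.Vertex := A.nonempty.map A.floor

noncomputable instance : OrderBot A.Vertex :=
  @Fintype.toOrderBot _ (Fintype.ofFinite _) _ _

theorem Vertex.exists_pred (v : A.Vertex) :
    ∃ p ≤ v, (v ≤ p → IsMin v) ∧ ∀ w < v, w ≤ p := by
  by_cases h : (Set.Iio v).Nonempty
  · obtain ⟨m, hm, hmax⟩ := Vertex.exists_max h fun w (hw : w < v) => hw.le
    exact ⟨m, hm.le, fun h' => absurd h' hm.not_ge, hmax⟩
  · refine ⟨v, le_rfl, fun _ w hw => ?_, fun w hw => absurd ⟨w, hw⟩ h⟩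
    by_contra hvw
    exact h ⟨w, lt_of_le_not_ge hw hvw⟩

noncomputable instance : PredOrder A.Vertex where
  pred v := (Vertex.exists_pred v).choose
  pred_le v := (Vertex.exists_pred v).choose_spec.1
  min_of_le_pred {v} := (Vertex.exists_pred v).choose_spec.2.1
  le_pred_of_lt {w v} := (Vertex.exists_pred v).choose_spec.2.2 w

variable (A)

/-- The merge tree with the given points. -/
noncomputable def toMergeTree : MergeTree.{u} where
  tree := { α := A.Vertex }
  finite := inferInstanceAs (Finite A.Vertex)
  height v := A.level (Subtype.val (p := fun x => A.level x ∈ A.critical) v)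
  strictAnti := Vertex.level_strictAnti

variable {A}

theorem level_lt_level_pred_floor {x : P} (h : A.floor x ≠ ⊥) :
    A.level x < A.level (Order.pred (A.floor x)).1 := by
  by_contra! hle
  have h1 := le_level_floor (Order.pred (A.floor x)).2 hle
  have h2 : A.level (A.floor x).1 < A.level (Order.pred (A.floor x)).1 :=
    Vertex.level_strictAnti (Order.pred_lt_of_not_isMin (by rwa [isMin_iff_eq_bot]))
  exact h1.not_gt h2

/-- If the floor were a proper ancestor of `v`, it would lie at least as high as the parent of `v`,
which is above `t`. -/
theorem floor_raise {v : A.Vertex} {t : ℝ} (h : A.level v.1 ≤ t)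
    (hlt : v ≠ ⊥ → t < A.level (Order.pred v).1) : A.floor (A.raise v.1 t) = v := by
  by_contra hne
  have hv : A.floor (A.raise v.1 t) < v := lt_of_le_of_ne (floor_le (anc_raise _ _)) hne
  have h1 : A.level (Order.pred v).1 ≤ A.level (A.floor (A.raise v.1 t)).1 :=
    Vertex.level_strictAnti.antitone (Order.le_pred_of_lt hv)
  have h2 := (anc_floor (A := A) (A.raise v.1 t)).level_le
  rw [A.level_raise, max_eq_left h] at h2
  exact (hlt (bot_le.trans_lt hv).ne').not_ge (h1.trans h2)

variable (A)

/-- The given points are the points of the underlying space of the merge tree. -/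
noncomputable def equivPt : P ≃ A.toMergeTree.Pt where
  toFun x := ⟨A.floor x, A.level x, (anc_floor (A := A) x).level_le, level_lt_level_pred_floor⟩
  invFun p := A.raise (Subtype.val (p := fun x => A.level x ∈ A.critical) p.vertex) p.level
  left_inv x := anc_floor x
  right_inv p := MergeTree.Pt.ext (floor_raise (A := A) p.le_level p.level_lt)
    ((A.level_raise _ _).trans (max_eq_left p.le_level))

theorem equivPt_level (x : P) : (A.equivPt x).level = A.level x := rfl

theorem equivPt_raise (x : P) (t : ℝ) :
    A.equivPt (A.raise x t) = (A.equivPt x).raise t := by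
  refine (MergeTree.Pt.raise_eq_of_le ⟨?_, ?_⟩ ?_).symm
  · exact floor_le ((anc_floor x).trans (anc_raise x t))
  · exact (anc_raise x t).level_le
  · exact A.level_raise x t

theorem equivPt_symm_raise (p : A.toMergeTree.Pt) (t : ℝ) :
    A.equivPt.symm (p.raise t) = A.raise (A.equivPt.symm p) t := by
  rw [Equiv.symm_apply_eq, equivPt_raise, Equiv.apply_symm_apply]

theorem level_equivPt_symm (p : A.toMergeTree.Pt) : A.level (A.equivPt.symm p) = p.level := by
  rw [← equivPt_level, Equiv.apply_symm_apply]

theorem le_equivPt_raise (x : P) (t : ℝ) : A.equivPt x ≤ A.equivPt (A.raise x t) := by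
  rw [equivPt_raise]
  exact MergeTree.Pt.le_raise _ _

theorem monotone_equivPt_comp {T : MergeTree.{u}} {f : T.Pt → P} {c : ℝ}
    (h : ∀ x t, f (x.raise t) = A.raise (f x) (t + c)) : Monotone fun x => A.equivPt (f x) :=
  fun x y hxy => by
    dsimp only
    rw [← MergeTree.Pt.raise_level_eq hxy, h]
    exact A.le_equivPt_raise _ _

theorem monotone_comp_equivPt_symm {T : MergeTree.{u}} {f : P → T.Pt} {c : ℝ}
    (h : ∀ x t, f (A.raise x t) = (f x).raise (t + c)) : Monotone fun p => f (A.equivPt.symm p) :=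
  fun x y hxy => by
    dsimp only
    rw [← MergeTree.Pt.raise_level_eq hxy, equivPt_symm_raise, h]
    exact MergeTree.Pt.le_raise _ _

/-- The up-sets of the vertices form a finite closed cover, and on each of them the inverse is the
path upward from one fixed point. -/
theorem continuous_equivPt_symm [TopologicalSpace P] (h : ∀ x, Continuous (A.raise x)) :
    Continuous A.equivPt.symm := by
  have := A.toMergeTree.finite
  refine (locallyFinite_of_finite fun v : A.toMergeTree.tree =>
    {p | MergeTree.Pt.ofVertex v ≤ p}).continuous ?_ (fun v => MergeTree.Pt.isClosed_Ici _) ?_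
  · exact Set.eq_univ_of_forall fun p => Set.mem_iUnion.mpr ⟨p.vertex, p.ofVertex_le⟩
  · intro v
    refine ((h (A.equivPt.symm (.ofVertex v))).comp
      MergeTree.Pt.continuous_level).continuousOn.congr fun p hp => ?_
    rw [Function.comp_apply, ← equivPt_symm_raise, MergeTree.Pt.raise_level_eq hp]

end LevelledTree

/-! ### Interleavings: attained infimum and good maps -/

namespace MergeTree

variable {T₁ T₂ : MergeTree.{u}}

theorem isUpperSet_range {α : T₁.Pt → T₂.Pt} {c : ℝ} (hα : Monotone α)
    (hc : ∀ u, (α u).level = u.level + c) : IsUpperSet (Set.range α) := by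
  rintro _ b hb ⟨u, rfl⟩
  refine ⟨u.raise (b.level - c), ?_⟩
  rw [Pt.map_raise_of_monotone hα hc, sub_add_cancel, Pt.raise_level_eq hb]

/-- An image point above `w` is `α u` for some `u`, and it also lies above the image of the vertex
below `u`. So only the finitely many joins of `w` with images of vertices compete; being ancestors
of `w`, they form a chain, whose lowest member is nearest. -/
theorem exists_isNearest {α : T₁.Pt → T₂.Pt} {c : ℝ} (hα : Monotone α)
    (hc : ∀ u, (α u).level = u.level + c) (w : T₂.Pt) : ∃ a, IsNearest α w a := by
  have := T₁.finite
  obtain ⟨v, hv⟩ := Finite.exists_min fun v => (w ⊔ α (.ofVertex v)).level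
  refine ⟨w ⊔ α (.ofVertex v),
    ⟨isUpperSet_range hα hc le_sup_right ⟨_, rfl⟩, le_sup_left⟩, ?_⟩
  rintro _ ⟨⟨u, rfl⟩, hu⟩
  exact (Pt.le_of_le_of_le le_sup_left le_sup_left (hv u.vertex)).trans
    (sup_le hu (hα u.ofVertex_le))

/-- Two monotone maps that shift heights by `ε` are interleaved as soon as both compositions move
points upwards. -/
theorem IsInterleaving.of_monotone {ε : ℝ≥0} {α : T₁.Pt → T₂.Pt} {β : T₂.Pt → T₁.Pt}
    (hα : Monotone α) (hβ : Monotone β) (lα : ∀ u, (α u).level = u.level + ε)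
    (lβ : ∀ w, (β w).level = w.level + ε) (h₁ : ∀ u, u ≤ β (α u)) (h₂ : ∀ w, w ≤ α (β w)) :
    IsInterleaving T₁ T₂ ε α β where
  continuous_left := Pt.continuous_of_monotone hα lα
  continuous_right := Pt.continuous_of_monotone hβ lβ
  level_left := lα
  level_right := lβ
  right_left u := Pt.eq_up (h₁ u) (by rw [lβ, lα]; push_cast; ring)
  left_right w := Pt.eq_up (h₂ w) (by rw [lα, lβ]; push_cast; ring)

/-- Climbing the missing `ε - δ` after each map keeps both maps monotone and both compositions
ascending. -/
theorem IsInterleaving.mono {ε δ : ℝ≥0} {α : T₁.Pt → T₂.Pt} {β : T₂.Pt → T₁.Pt}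
    (h : IsInterleaving T₁ T₂ δ α β) (hδ : δ ≤ ε) :
    IsInterleaving T₁ T₂ ε (fun u => (α u).raise (u.level + ε))
      fun w => (β w).raise (w.level + ε) := by
  have hα := Pt.monotone_of_continuous h.continuous_left h.level_left
  have hβ := Pt.monotone_of_continuous h.continuous_right h.level_right
  have hδ' : (δ : ℝ) ≤ ε := hδ
  refine .of_monotone (fun u v huv => ?_) (fun u v huv => ?_) (fun u => ?_) (fun w => ?_)
    (fun u => ?_) fun w => ?_
  · exact Pt.le_of_le_of_le (Pt.le_raise _ _) ((hα huv).trans (Pt.le_raise _ _)) (by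
      rw [Pt.raise_level_of_le, Pt.raise_level_of_le] <;> linarith [h.level_left u,
        h.level_left v, huv.2])
  · exact Pt.le_of_le_of_le (Pt.le_raise _ _) ((hβ huv).trans (Pt.le_raise _ _)) (by
      rw [Pt.raise_level_of_le, Pt.raise_level_of_le] <;> linarith [h.level_right u,
        h.level_right v, huv.2])
  · rw [Pt.raise_level_of_le]; linarith [h.level_left u]
  · rw [Pt.raise_level_of_le]; linarith [h.level_right w]
  · have h1 : u ≤ β (α u) := h.right_left u ▸ u.le_up _
    exact h1.trans ((hβ (Pt.le_raise _ _)).trans (Pt.le_raise _ _))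
  · have h1 : w ≤ α (β w) := h.left_right w ▸ w.le_up _
    exact h1.trans ((hα (Pt.le_raise _ _)).trans (Pt.le_raise _ _))

/-- A monotone map that shifts heights by `d` descends to one that shifts heights by `c`, if the
target has no vertices in between. -/
theorem exists_monotone_shift {c d : ℝ} (hcd : c ≤ d) {α : T₁.Pt → T₂.Pt} (hα : Monotone α)
    (lα : ∀ u, (α u).level = u.level + d)
    (h : ∀ v w, T₂.height w ∉ Set.Ioc (T₁.height v + c) (T₁.height v + d)) :
    ∃ α' : T₁.Pt → T₂.Pt, Monotone α' ∧ (∀ u, (α' u).level = u.level + c) ∧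
      ∀ u, α' u ≤ α u := by
  have hlow : ∀ v, T₂.height (α (.ofVertex v)).vertex ≤ T₁.height v + c := fun v => by
    by_contra! hlt
    exact h v _ ⟨hlt, (α (.ofVertex v)).le_level.trans_eq (lα _)⟩
  have hle : ∀ v, T₁.height v + c ≤ (α (.ofVertex v)).level := fun v => by
    rw [lα]; exact add_le_add_right hcd _
  -- The edge of `α v` extends down to height `T₁.height v + c`, since otherwise its lower end would
  -- lie in the excluded interval. Images of vertices are lowered along their edges; other points
  -- follow by climbing.
  set f : T₁.tree → T₂.Pt := fun v => (α (.ofVertex v)).lower _ (hlow v) (hle v)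
  have hfα : ∀ v, f v ≤ α (.ofVertex v) := fun v => Pt.lower_le _ _ _ _
  have lf : ∀ v, (f v).level = T₁.height v + c := fun v => rfl
  have hmono : ∀ {v w}, v ≤ w → f w ≤ f v := fun {v w} hvw => by
    have hh := T₁.strictAnti.antitone hvw
    have hwv : α (.ofVertex w) ≤ α (.ofVertex v) := hα ⟨hvw, hh⟩
    have : (f w).raise (T₁.height v + c) = f v := by
      refine Pt.eq_of_le_of_forall_notMem
        (Pt.raise_le ((hfα w).trans hwv) ((lf v).symm.trans_le (hfα v).2)) (hfα v) ?_ fun x => ?_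
      · rw [Pt.raise_level_of_le (by rw [lf]; linarith), lf]
      · rw [Pt.raise_level_of_le (by rw [lf]; linarith), lα]
        exact h v x
    rw [← this]
    exact Pt.le_raise _ _
  have lα' : ∀ u : T₁.Pt, ((f u.vertex).raise (u.level + c)).level = u.level + c := fun u =>
    Pt.raise_level_of_le (by rw [lf]; linarith [u.le_level])
  refine ⟨fun u => (f u.vertex).raise (u.level + c), fun u u' hu => ?_, lα', fun u => ?_⟩
  · exact Pt.le_of_le_of_le (Pt.le_raise _ _) ((hmono hu.1).trans (Pt.le_raise _ _)) (by
      rw [lα', lα']; linarith [hu.2])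
  · exact Pt.raise_le ((hfα _).trans (hα u.ofVertex_le)) (by rw [lα]; linarith)

/-- If a monotone shift `γ` is bounded by an upward shift and no vertex lies in between, then it is
an upward shift itself. -/
theorem le_of_le_raise {T : MergeTree.{u}} {c d : ℝ} (hc : 0 ≤ c) {γ γ' : T.Pt → T.Pt}
    (hγ : Monotone γ) (lγ : ∀ u, (γ u).level = u.level + c) (hγγ' : ∀ u, γ u ≤ γ' u)
    (lγ' : ∀ u, (γ' u).level = u.level + d) (hγ' : ∀ u, u ≤ γ' u)
    (h : ∀ v w, T.height w ∉ Set.Ioc (T.height v + c) (T.height v + d)) (u : T.Pt) :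
    u ≤ γ u := by
  set x : T.Pt := .ofVertex u.vertex
  have hxl : x.level = T.height u.vertex := rfl
  have h1 : x.raise (x.level + c) = γ x := by
    refine Pt.eq_of_le_of_forall_notMem (z := γ' x) (Pt.raise_le (hγ' x) ?_) (hγγ' x) ?_ ?_
    · rw [← lγ]; exact (hγγ' x).2
    · rw [Pt.raise_level_of_le (by linarith), lγ]
    · rw [Pt.raise_level_of_le (by linarith), lγ']
      exact h u.vertex
  refine Pt.le_of_le_of_le u.ofVertex_le ((x.le_raise _).trans (h1.trans_le (hγ u.ofVertex_le))) ?_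
  rw [lγ]; linarith

theorem exists_pos_forall_notMem_Ioc {s : Set ℝ} (hs : s.Finite) :
    ∃ r > 0, ∀ d ∈ s, d ∉ Set.Ioc 0 r := by
  rcases (s ∩ Set.Ioi 0).eq_empty_or_nonempty with h | h
  · exact ⟨1, one_pos, fun d hd hd' => (h ▸ ⟨hd, hd'.1⟩ : d ∈ (∅ : Set ℝ))⟩
  · obtain ⟨m, hm, hmin⟩ := Set.exists_min_image _ id (hs.inter_of_left _) h
    have hm0 : 0 < m := hm.2
    refine ⟨m / 2, by positivity, fun d hd hd' => ?_⟩
    have := hmin d ⟨hd, hd'.1⟩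
    simp only [id] at this
    linarith [hd'.2]

/-- The infimum in the definition of the interleaving distance is attained. -/
theorem exists_isInterleaving {ε : ℝ≥0} (h : T₁.interleavingDist T₂ ≤ ε) :
    ∃ α β, IsInterleaving T₁ T₂ ε α β := by
  have := T₁.finite
  have := T₂.finite
  -- The first two families control the lowering of `α` and `β` from `δ` to `ε`, the last two the
  -- compositions, lowered from `2δ` to `2ε`; this is why `δ` is taken within `r / 2` of `ε`.
  set s : Set ℝ := Set.range (fun p : T₁.tree × T₂.tree => T₂.height p.2 - T₁.height p.1 - ε) ∪
    Set.range (fun p : T₁.tree × T₂.tree => T₁.height p.1 - T₂.height p.2 - ε) ∪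
    Set.range (fun p : T₁.tree × T₁.tree => T₁.height p.2 - T₁.height p.1 - (ε + ε)) ∪
    Set.range (fun p : T₂.tree × T₂.tree => T₂.height p.2 - T₂.height p.1 - (ε + ε))
  obtain ⟨r, hr, hsr⟩ := exists_pos_forall_notMem_Ioc (s := s) (by
    refine (((Set.finite_range _).union ?_).union ?_).union ?_ <;> exact Set.finite_range _)
  obtain ⟨δ, hδ, α, β, hαβ⟩ : ∃ δ : ℝ≥0, (δ : ℝ) < ε + r / 2 ∧ ∃ α β,
      IsInterleaving T₁ T₂ δ α β := by
    have hlt : T₁.interleavingDist T₂ < ((ε + (r / 2).toNNReal : ℝ≥0) : ℝ≥0∞) := by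
      refine h.trans_lt (ENNReal.coe_lt_coe.mpr ?_)
      exact lt_add_of_pos_right _ (Real.toNNReal_pos.mpr (by positivity))
    obtain ⟨δ, hδ⟩ := iInf_lt_iff.mp hlt
    obtain ⟨hex, hδ⟩ := iInf_lt_iff.mp hδ
    refine ⟨δ, ?_, hex⟩
    have := NNReal.coe_lt_coe.mpr (ENNReal.coe_lt_coe.mp hδ)
    rwa [NNReal.coe_add, Real.coe_toNNReal _ (by positivity)] at this
  rcases le_or_gt δ ε with hle | hgt
  · exact ⟨_, _, hαβ.mono hle⟩
  have hgt' : (ε : ℝ) < δ := hgt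
  have hα := Pt.monotone_of_continuous hαβ.continuous_left hαβ.level_left
  have hβ := Pt.monotone_of_continuous hαβ.continuous_right hαβ.level_right
  obtain ⟨α', hα', lα', hαα'⟩ := exists_monotone_shift hgt'.le hα hαβ.level_left
    fun v w hw => hsr _ (.inl <| .inl <| .inl ⟨(v, w), rfl⟩) ⟨by linarith [hw.1], by
      linarith [hw.2]⟩
  obtain ⟨β', hβ', lβ', hββ'⟩ := exists_monotone_shift hgt'.le hβ hαβ.level_right
    fun v w hw => hsr _ (.inl <| .inl <| .inr ⟨(w, v), rfl⟩) ⟨by linarith [hw.1], by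
      linarith [hw.2]⟩
  refine ⟨α', β', .of_monotone hα' hβ' lα' lβ' ?_ ?_⟩
  · refine le_of_le_raise (c := ε + ε) (d := δ + δ) (by positivity) (hβ'.comp hα')
      (fun u => ?_) (fun u => (hββ' _).trans (hβ (hαα' u))) (fun u => ?_)
      (fun u => hαβ.right_left u ▸ u.le_up _) fun v w hw => ?_
    · rw [lβ', lα', add_assoc]
    · rw [hαβ.level_right, hαβ.level_left, add_assoc]
    · exact hsr _ (.inl <| .inr ⟨(v, w), rfl⟩) ⟨by linarith [hw.1], by linarith [hw.2]⟩
  · refine le_of_le_raise (c := ε + ε) (d := δ + δ) (by positivity) (hα'.comp hβ')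
      (fun u => ?_) (fun u => (hαα' _).trans (hα (hββ' u))) (fun u => ?_)
      (fun u => hαβ.left_right u ▸ u.le_up _) fun v w hw => ?_
    · rw [lα', lβ', add_assoc]
    · rw [hαβ.level_left, hαβ.level_right, add_assoc]
    · exact hsr _ (.inr ⟨(v, w), rfl⟩) ⟨by linarith [hw.1], by linarith [hw.2]⟩

/-- Applying `β` transfers the order back. The point `w^{2ε} = α (β w)` lies in the image, so the
nearest image point is at most `2ε` above `w`. -/
theorem IsInterleaving.isGoodMap {ε : ℝ≥0} {α : T₁.Pt → T₂.Pt} {β : T₂.Pt → T₁.Pt}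
    (h : IsInterleaving T₁ T₂ ε α β) : IsGoodMap T₁ T₂ ε α where
  continuous := h.continuous_left
  level := h.level_left
  le_of_le u₁ u₂ hu := by
    rw [← h.right_left, ← h.right_left]
    exact Pt.monotone_of_continuous h.continuous_right h.level_right hu
  nearest w _ := by
    obtain ⟨a, ha⟩ := exists_isNearest
      (Pt.monotone_of_continuous h.continuous_left h.level_left) h.level_left w
    refine ⟨a, ha, ?_⟩
    have := Pt.level_mono (ha.2 ⟨⟨β w, h.left_right w⟩, w.le_up (2 * ε)⟩)
    rw [Pt.up_level] at this
    push_cast at this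
    linarith

theorem nonempty_meanTreeData {ε : ℝ≥0} (h : T₁.interleavingDist T₂ ≤ ε) :
    Nonempty (MeanTreeData T₁ T₂ ε) := by
  obtain ⟨α, β, hαβ⟩ := exists_isInterleaving h
  have hex : ∀ a : T₂.Pt, ∃ c, a ∈ Set.range α → α c = a := fun a => by
    by_cases ha : a ∈ Set.range α
    · exact ha.imp fun c hc _ => hc
    · exact ⟨β a, fun h => absurd h ha⟩
  choose c hc using hex
  exact ⟨⟨α, hαβ.isGoodMap, c, fun w a _ ha => hc a ha.1.1⟩⟩

theorem interleavingDist_le_of_monotone {ε : ℝ≥0} {α : T₁.Pt → T₂.Pt} {β : T₂.Pt → T₁.Pt}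
    (hα : Monotone α) (hβ : Monotone β) (lα : ∀ u, (α u).level = u.level + ε)
    (lβ : ∀ w, (β w).level = w.level + ε) (h₁ : ∀ u, u ≤ β (α u)) (h₂ : ∀ w, w ≤ α (β w)) :
    T₁.interleavingDist T₂ ≤ ε :=
  iInf₂_le ε ⟨α, β, .of_monotone hα hβ lα lβ h₁ h₂⟩

end MergeTree

/-! ### Roots, trimmed subtrees and ancestors in the mean tree -/

theorem Set.Finite.exists_greatest_le {s : Set ℝ} (hs : s.Finite) {x t : ℝ} (hx : x ∈ s)
    (hxt : x ≤ t) : ∃ m ∈ s, m ≤ t ∧ ∀ y ∈ s, y ≤ t → y ≤ m := by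
  obtain ⟨m, hm, hmax⟩ := Set.exists_max_image (s ∩ Set.Iic t) id (hs.inter_of_left _) ⟨x, hx, hxt⟩
  exact ⟨m, hm.1, hm.2, fun y hy hyt => hmax y ⟨hy, hyt⟩⟩

namespace MergeTree

namespace MeanTreeData

variable {T₁ T₂ : MergeTree.{u}} {ε : ℝ≥0} (D : MeanTreeData T₁ T₂ ε)

theorem monotone_α : Monotone D.α := Pt.monotone_of_continuous D.good.continuous D.good.level

theorem α_raise (u : T₁.Pt) (t : ℝ) : D.α (u.raise t) = (D.α u).raise (t + ε) :=
  Pt.map_raise_of_monotone D.monotone_α D.good.level u t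

theorem isUpperSet_range_α : IsUpperSet (Set.range D.α) :=
  isUpperSet_range D.monotone_α D.good.level

/-- The nearest ancestor of `w` in the image of `α`, which is `w` itself if it lies there. -/
noncomputable def root (w : T₂.Pt) : T₂.Pt :=
  (exists_isNearest D.monotone_α D.good.level w).choose

theorem isNearest_root (w : T₂.Pt) : IsNearest D.α w (D.root w) :=
  (exists_isNearest D.monotone_α D.good.level w).choose_spec

theorem root_mem_range (w : T₂.Pt) : D.root w ∈ Set.range D.α := (D.isNearest_root w).1.1

theorem le_root (w : T₂.Pt) : w ≤ D.root w := (D.isNearest_root w).1.2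

theorem root_le {w b : T₂.Pt} (hb : b ∈ Set.range D.α) (h : w ≤ b) : D.root w ≤ b :=
  (D.isNearest_root w).2 ⟨hb, h⟩

theorem root_eq {w a : T₂.Pt} (h : IsNearest D.α w a) : D.root w = a :=
  (D.isNearest_root w).unique h

theorem root_of_mem {w : T₂.Pt} (h : w ∈ Set.range D.α) : D.root w = w :=
  le_antisymm (D.root_le h le_rfl) (D.le_root w)

theorem root_eq_of_le {w w' : T₂.Pt} (h : w ≤ w') (h' : w' ≤ D.root w) : D.root w' = D.root w :=
  le_antisymm (D.root_le (D.root_mem_range w) h')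
    (D.root_le (D.root_mem_range w') (h.trans (D.le_root w')))

theorem level_lt_level_root {w : T₂.Pt} (h : w ∉ Set.range D.α) : w.level < (D.root w).level :=
  lt_of_le_of_ne (D.le_root w).2 fun he =>
    h (by rw [Pt.eq_of_le_of_le le_rfl (D.le_root w) he]; exact D.root_mem_range w)

theorem root_mem_roots {w : T₂.Pt} (h : w ∉ Set.range D.α) : D.root w ∈ D.roots :=
  ⟨w, h, D.isNearest_root w⟩

theorem roots_subset_range : D.roots ⊆ Set.range D.α := fun _ ⟨_, _, h⟩ => h.1.1

theorem level_root_le (w : T₂.Pt) : (D.root w).level ≤ w.level + 2 * ε := by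
  by_cases h : w ∈ Set.range D.α
  · rw [D.root_of_mem h]
    linarith [ε.coe_nonneg]
  · obtain ⟨a, ha, hle⟩ := D.good.nearest w h
    rw [D.root_eq ha]
    linarith

/-- Image points are their own `root`, so roots and proper subtree points can be treated by one
condition. -/
theorem mem_trimmed_iff {w : T₂.Pt} :
    w ∈ D.trimmed ↔ D.root w ∈ D.roots ∧ (D.root w).level - ε ≤ w.level := by
  constructor
  · rintro (h | ⟨h, a, ha, hle⟩)
    · rw [D.root_of_mem (D.roots_subset_range h)]
      exact ⟨h, sub_le_self _ ε.coe_nonneg⟩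
    · rw [D.root_eq ha]
      exact ⟨⟨w, h, ha⟩, hle⟩
  · rintro ⟨h, hle⟩
    by_cases hw : w ∈ Set.range D.α
    · rw [D.root_of_mem hw] at h
      exact .inl h
    · exact .inr ⟨hw, _, D.isNearest_root w, hle⟩

theorem α_attach_root {a : T₂.Pt} (h : a ∈ D.roots) : D.α (D.attach a) = a :=
  h.elim fun w hw => D.α_attach w a hw.1 hw.2

theorem attach_level {a : T₂.Pt} (h : a ∈ D.roots) : (D.attach a).level = a.level - ε := by
  have := D.good.level (D.attach a)
  rw [D.α_attach_root h] at this
  linarith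

theorem root_raise {w : T₂.Pt} {s : ℝ} (hs : s ≤ (D.root w).level) :
    D.root (w.raise s) = D.root w :=
  D.root_eq_of_le (w.le_raise s) (Pt.raise_le (D.le_root w) hs)

theorem raise_mem_trimmed {w : T₂.Pt} (hw : w ∈ D.trimmed) {s : ℝ} (hs : s ≤ (D.root w).level) :
    w.raise s ∈ D.trimmed := by
  rw [mem_trimmed_iff] at hw ⊢
  rw [D.root_raise hs]
  exact ⟨hw.1, hw.2.trans (w.le_raise s).2⟩

/-- The roots are branching points of `T₂` or images of vertices of `T₁`. -/
theorem finite_roots : D.roots.Finite := by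
  have := T₁.finite
  have := T₂.finite
  refine (Pt.finite_level_mem ((Set.finite_range T₂.height).union
    (Set.finite_range fun v => T₁.height v + ε))).subset fun a ha => ?_
  obtain ⟨w, hw, hwa⟩ := id ha
  by_contra hS
  have hlu := D.attach_level ha
  have h1 : w.level < a.level := D.root_eq hwa ▸ D.level_lt_level_root hw
  have h2 : T₂.height a.vertex < a.level :=
    lt_of_le_of_ne a.le_level fun h => hS (.inl ⟨_, h⟩)
  have h3 : T₁.height (D.attach a).vertex + ε < a.level :=
    lt_of_le_of_ne (by linarith [(D.attach a).le_level]) fun h => hS (.inr ⟨_, h⟩)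
  -- Just below a root at no exceptional height, the edge of `a` in `T₂` and the edge of its
  -- preimage in `T₁` both continue down to `m`. Hence the path from `w` already meets the image at
  -- height `m`, against the choice of `a`.
  set m := max w.level (max (T₂.height a.vertex) (T₁.height (D.attach a).vertex + ε))
  have hma : m < a.level := max_lt h1 (max_lt h2 h3)
  have hm2 : T₂.height a.vertex ≤ m := (le_max_left _ _).trans (le_max_right _ _)
  have hm3 : T₁.height (D.attach a).vertex + ε ≤ m := (le_max_right _ _).trans (le_max_right _ _)
  have hwm : (w.raise m).level = m := Pt.raise_level_of_le (le_max_left _ _)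
  have heq : w.raise m = D.α ((D.attach a).lower (m - ε) (by linarith) (by linarith)) := by
    refine Pt.eq_of_le_of_height_le (z := a) (Pt.raise_le hwa.1.2 hma.le) ?_ ?_ ?_
    · exact (D.monotone_α (Pt.lower_le _ _ _ _)).trans_eq (D.α_attach_root ha)
    · rw [hwm, D.good.level]
      exact (sub_add_cancel _ _).symm
    · rwa [hwm]
  have := (hwa.2 ⟨⟨_, heq.symm⟩, w.le_raise m⟩).2
  rw [hwm] at this
  exact this.not_gt hma

/-- The point of the mean tree given by a point of `T₁`. -/
def mk₁ (p : T₁.Pt) : D.Mean := Quot.mk _ (.inl p)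

/-- The point of the mean tree given by a point of a trimmed subtree. -/
def mk₂ (w : D.trimmed) : D.Mean := Quot.mk _ (.inr w)

theorem continuous_mk₁ : Continuous D.mk₁ := continuous_quot_mk.comp continuous_inl

theorem continuous_mk₂ : Continuous D.mk₂ := continuous_quot_mk.comp continuous_inr

theorem k_mk₁ (p : T₁.Pt) : D.k (D.mk₁ p) = p.level + ε / 2 := rfl

theorem k_mk₂ (w : D.trimmed) : D.k (D.mk₂ w) = w.1.level - ε / 2 := rfl

theorem mk₁_attach {a : T₂.Pt} (ha : a ∈ D.roots) : D.mk₁ (D.attach a) = D.mk₂ ⟨a, .inl ha⟩ :=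
  Quot.sound (.attach a ha)

variable {D}

theorem mk₂_of_mem {w : D.trimmed} (hw : w.1 ∈ Set.range D.α) :
    D.mk₂ w = D.mk₁ (D.attach w.1) := by
  have := (D.mem_trimmed_iff.mp w.2).1
  rw [D.root_of_mem hw] at this
  exact (D.mk₁_attach this).symm

theorem mean_induction {motive : D.Mean → Prop} (h₁ : ∀ p, motive (D.mk₁ p))
    (h₂ : ∀ w : D.trimmed, w.1 ∉ Set.range D.α → motive (D.mk₂ w)) (x : D.Mean) : motive x := by
  obtain ⟨p | w, rfl⟩ := Quot.exists_rep x
  · exact h₁ p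
  · by_cases hw : w.1 ∈ Set.range D.α
    · change motive (D.mk₂ w)
      rw [mk₂_of_mem hw]
      exact h₁ _
    · exact h₂ w hw

/-- Points of `T₁` with the same image under `α` are identified from height `ε` above on, whether
they are vertices of the augmented tree or not. -/
theorem mk₁_raise_eq {u₁ u₂ : T₁.Pt} (h : D.α u₁ = D.α u₂) {s : ℝ} (hs : u₁.level + ε ≤ s) :
    D.mk₁ (u₁.raise s) = D.mk₁ (u₂.raise s) := by
  have := T₁.finite
  have := T₂.finite
  have hl : u₁.level = u₂.level := by
    have := congrArg Pt.level h
    rw [D.good.level, D.good.level] at this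
    linarith
  -- Both points are lowered along their edges to the greatest augmented height `m`. Their images
  -- still agree, because `T₂` has no vertex height in `(m + ε, u₁.level + ε]`.
  obtain ⟨m, hm, hmu, hmax⟩ := ((Set.finite_range T₁.height).union
    (Set.finite_range fun v => T₂.height v - ε)).exists_greatest_le (.inl ⟨u₁.vertex, rfl⟩)
    u₁.le_level
  have h1 := hmax _ (.inl ⟨u₁.vertex, rfl⟩) u₁.le_level
  have h2 := hmax _ (.inl ⟨u₂.vertex, rfl⟩) (u₂.le_level.trans_eq hl.symm)
  refine Quot.sound (.merge (u₁.lower m h1 hmu) (u₂.lower m h2 (hmu.trans_eq hl)) _ _ hm hm ?_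
    ((u₁.lower_le _ _ _).trans (u₁.le_raise s)) ((u₂.lower_le _ _ _).trans (u₂.le_raise s))
    (by rw [Pt.raise_level, Pt.raise_level, hl]) ?_)
  · refine Pt.eq_of_le_of_forall_notMem (D.monotone_α (u₁.lower_le _ _ _))
      (h ▸ D.monotone_α (u₂.lower_le _ _ _)) (by rw [D.good.level, D.good.level]; rfl)
      fun v hv => ?_
    rw [D.good.level, D.good.level] at hv
    have h3 : T₂.height v - ε ≤ m := hmax _ (.inr ⟨v, rfl⟩) (by linarith [hv.2])
    have h4 : m + ε < T₂.height v := hv.1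
    linarith
  · rw [Pt.raise_level]
    exact (by linarith : m + ε ≤ s).trans (le_max_left _ _)

variable (D)

/-- The point `w` of a trimmed subtree, moved up to height `s` or to the root of the subtree. -/
noncomputable def trimmedRaise (w : D.trimmed) (s : ℝ) : D.trimmed :=
  ⟨w.1.raise (min s (D.root w.1).level), D.raise_mem_trimmed w.2 (min_le_right _ _)⟩

/-- The ancestor of `x` at height `t`, or `x` itself if it lies above this height. -/
noncomputable def raise (x : D.Mean) (t : ℝ) : D.Mean :=
  Quot.lift (Sum.elim (fun p => D.mk₁ (p.raise (t - ε / 2))) fun w =>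
    if (D.root w.1).level ≤ t + ε / 2 then D.mk₁ ((D.attach (D.root w.1)).raise (t - ε / 2))
    else D.mk₂ (D.trimmedRaise w (t + ε / 2)))
    (by
      rintro _ _ (⟨a, ha⟩ | ⟨u₁, u₂, p₁, p₂, hu₁, hu₂, hα, h₁, h₂, hp, hε⟩)
      · have hr := D.root_of_mem (D.roots_subset_range ha)
        simp only [Sum.elim_inl, Sum.elim_inr, hr]
        split_ifs with h
        · rfl
        · rw [Pt.raise_of_le (by rw [D.attach_level ha]; linarith), D.mk₁_attach ha]
          congr 1
          refine Subtype.ext (Pt.raise_of_le ?_).symm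
          rw [hr]
          exact min_le_right _ _
      · exact Quot.sound (.merge u₁ u₂ _ _ hu₁ hu₂ hα (h₁.trans (p₁.le_raise _))
          (h₂.trans (p₂.le_raise _)) (by rw [Pt.raise_level, Pt.raise_level, hp])
          (hε.trans (p₁.le_raise _).2))) x

theorem raise_mk₁ (p : T₁.Pt) (t : ℝ) : D.raise (D.mk₁ p) t = D.mk₁ (p.raise (t - ε / 2)) := rfl

theorem raise_mk₂_of_ge {w : D.trimmed} {t : ℝ} (h : (D.root w.1).level ≤ t + ε / 2) :
    D.raise (D.mk₂ w) t = D.mk₁ ((D.attach (D.root w.1)).raise (t - ε / 2)) := if_pos h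

theorem raise_mk₂_of_lt {w : D.trimmed} {t : ℝ} (h : t + ε / 2 < (D.root w.1).level) :
    D.raise (D.mk₂ w) t = D.mk₂ ⟨w.1.raise (t + ε / 2), D.raise_mem_trimmed w.2 h.le⟩ := by
  refine (if_neg h.not_ge).trans (congrArg D.mk₂ (Subtype.ext ?_))
  exact congrArg w.1.raise (min_eq_left h.le)

theorem raise_mk₂_of_le {w : D.trimmed} {t : ℝ} (h : t + ε / 2 ≤ (D.root w.1).level) :
    D.raise (D.mk₂ w) t = D.mk₂ ⟨w.1.raise (t + ε / 2), D.raise_mem_trimmed w.2 h⟩ := by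
  rcases h.lt_or_eq with h' | h'
  · exact D.raise_mk₂_of_lt h'
  · have hr := (D.mem_trimmed_iff.mp w.2).1
    have hw : w.1.raise (t + ε / 2) = D.root w.1 := by
      rw [h', Pt.raise_level_eq (D.le_root _)]
    rw [D.raise_mk₂_of_ge h'.ge, Pt.raise_of_le (by rw [D.attach_level hr]; linarith),
      D.mk₁_attach hr]
    congr 1
    exact Subtype.ext hw.symm

theorem k_raise (x : D.Mean) (t : ℝ) : D.k (D.raise x t) = max t (D.k x) := by
  induction x using mean_induction with
  | h₁ p => rw [raise_mk₁, k_mk₁, k_mk₁, Pt.raise_level, ← max_add_add_right, sub_add_cancel]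
  | h₂ w hw =>
    have hr := D.attach_level (D.mem_trimmed_iff.mp w.2).1
    have hle := (D.le_root w.1).2
    rcases le_or_gt (D.root w.1).level (t + ε / 2) with h | h
    · rw [D.raise_mk₂_of_ge h, k_mk₁, k_mk₂, Pt.raise_level_of_le (by linarith),
        max_eq_left (by linarith), sub_add_cancel]
    · rw [D.raise_mk₂_of_lt h, k_mk₂, k_mk₂, Pt.raise_level, ← max_sub_sub_right,
        add_sub_cancel_right]

theorem raise_raise (x : D.Mean) (s t : ℝ) : D.raise (D.raise x s) t = D.raise x (max s t) := by
  induction x using mean_induction with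
  | h₁ p => rw [raise_mk₁, raise_mk₁, raise_mk₁, Pt.raise_raise, max_sub_sub_right]
  | h₂ w hw =>
    rcases le_or_gt (D.root w.1).level (s + ε / 2) with h | h
    · rw [D.raise_mk₂_of_ge h, raise_mk₁, Pt.raise_raise, max_sub_sub_right,
        D.raise_mk₂_of_ge (h.trans (by gcongr; exact le_max_left _ _))]
    · have hr := D.root_raise h.le
      rw [D.raise_mk₂_of_lt h]
      rcases le_or_gt (D.root w.1).level (t + ε / 2) with h' | h'
      · rw [D.raise_mk₂_of_ge ((congrArg Pt.level hr).trans_le h'), max_eq_right (by linarith),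
          D.raise_mk₂_of_ge h']
        dsimp only
        rw [hr]
      · rw [D.raise_mk₂_of_lt (h'.trans_eq (congrArg Pt.level hr).symm), D.raise_mk₂_of_lt (by
          rw [← max_add_add_right]; exact max_lt h h')]
        congr 1
        refine Subtype.ext ?_
        dsimp only
        rw [Pt.raise_raise, max_add_add_right]

theorem raise_of_le (x : D.Mean) (t : ℝ) (h : t ≤ D.k x) : D.raise x t = x := by
  induction x using mean_induction with
  | h₁ p =>
    rw [k_mk₁] at h
    rw [raise_mk₁, Pt.raise_of_le (by linarith)]
  | h₂ w hw =>
    rw [k_mk₂] at h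
    rw [D.raise_mk₂_of_le (by linarith [(D.le_root w.1).2])]
    congr 1
    exact Subtype.ext (Pt.raise_of_le (by linarith))

theorem continuous_raise (x : D.Mean) : Continuous (D.raise x) := by
  induction x using mean_induction with
  | h₁ p =>
    exact D.continuous_mk₁.comp ((Pt.continuous_raise_const p).comp (by fun_prop))
  | h₂ w hw =>
    have hr := (D.mem_trimmed_iff.mp w.2).1
    refine Continuous.if_le (f := fun _ => (D.root w.1).level) (g := fun t : ℝ => t + ε / 2)
      (D.continuous_mk₁.comp ((Pt.continuous_raise_const _).comp (by fun_prop)))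
      (D.continuous_mk₂.comp (Continuous.subtype_mk
        ((Pt.continuous_raise_const _).comp (by fun_prop)) _)) (by fun_prop) (by fun_prop) ?_
    intro t ht
    rw [← D.raise_mk₂_of_ge ht.le, D.raise_mk₂_of_le ht.ge]
    congr 1
    exact Subtype.ext (congrArg w.1.raise (min_eq_left ht.ge).symm)

theorem exists_raise_eq_mk₁ (x : D.Mean) : ∃ t p, D.raise x t = D.mk₁ p := by
  induction x using mean_induction with
  | h₁ p => exact ⟨_, _, D.raise_mk₁ p 0⟩
  | h₂ w hw => exact ⟨_, _, D.raise_mk₂_of_ge (t := (D.root w.1).level - ε / 2) (by simp)⟩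

theorem exists_raise_eq (x y : D.Mean) : ∃ t, D.raise x t = D.raise y t := by
  obtain ⟨s, p, hp⟩ := D.exists_raise_eq_mk₁ x
  obtain ⟨t, q, hq⟩ := D.exists_raise_eq_mk₁ y
  obtain ⟨r, hr⟩ := Pt.exists_raise_eq p q
  set m := max (max s t) (r + ε / 2)
  have hs : max s m = m := max_eq_right ((le_max_left _ _).trans (le_max_left _ _))
  have ht : max t m = m := max_eq_right ((le_max_right _ _).trans (le_max_left _ _))
  have hrm : max r (m - ε / 2) = m - ε / 2 :=
    max_eq_right (by linarith [le_max_right (max s t) (r + ε / 2)])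
  refine ⟨m, ?_⟩
  rw [← hs, ← raise_raise, hp, hs, ← ht, ← raise_raise D y, hq, ht, raise_mk₁, raise_mk₁, ← hrm,
    ← Pt.raise_raise, hr, Pt.raise_raise]

end MeanTreeData

end MergeTree

/-! ### Critical heights and absence of branching in between -/

namespace MergeTree

namespace MeanTreeData

variable {T₁ T₂ : MergeTree.{u}} {ε : ℝ≥0} (D : MeanTreeData T₁ T₂ ε)

/-- The heights at which the mean tree may have vertices. -/
def critical : Set ℝ :=
  Set.range (fun v => T₁.height v + ε / 2) ∪ Set.range (fun v => T₂.height v - ε / 2) ∪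
  -- In the heights of the mean tree, these are where the merges start, where subtrees are attached,
  -- and where they are cut off.
  ((fun u => u.level + ε + ε / 2) '' augmentedVertices T₁ T₂ ε ∪
  ((fun a => a.level - ε / 2) '' D.roots ∪ (fun a => a.level - ε - ε / 2) '' D.roots))

theorem finite_augmentedVertices (T₁ T₂ : MergeTree.{u}) (ε : ℝ≥0) :
    (augmentedVertices T₁ T₂ ε).Finite := by
  have := T₁.finite
  have := T₂.finite
  exact Pt.finite_level_mem ((Set.finite_range T₁.height).union
    (Set.finite_range fun v => T₂.height v - ε))

theorem finite_critical : D.critical.Finite := by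
  have := T₁.finite
  have := T₂.finite
  exact ((Set.finite_range _).union (Set.finite_range _)).union
    (((finite_augmentedVertices T₁ T₂ ε).image _).union
      ((D.finite_roots.image _).union (D.finite_roots.image _)))

theorem height₁_mem_critical (v : T₁.tree) : T₁.height v + ε / 2 ∈ D.critical := .inl (.inl ⟨v, rfl⟩)

theorem height₂_mem_critical (v : T₂.tree) : T₂.height v - ε / 2 ∈ D.critical := .inl (.inr ⟨v, rfl⟩)

theorem augmented_mem_critical {u : T₁.Pt} (h : u ∈ augmentedVertices T₁ T₂ ε) :
    u.level + ε + ε / 2 ∈ D.critical := .inr (.inl ⟨u, h, rfl⟩)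

theorem root_mem_critical {a : T₂.Pt} (h : a ∈ D.roots) : a.level - ε / 2 ∈ D.critical :=
  .inr (.inr (.inl ⟨a, h, rfl⟩))

theorem root_sub_mem_critical {a : T₂.Pt} (h : a ∈ D.roots) :
    a.level - ε - ε / 2 ∈ D.critical := .inr (.inr (.inr ⟨a, h, rfl⟩))

theorem finite_k_mem_critical : {x | D.k x ∈ D.critical}.Finite := by
  have h₁ := Pt.finite_level_mem (T := T₁) (D.finite_critical.image fun s : ℝ => s - (ε : ℝ) / 2)
  have h₂ := Pt.finite_level_mem (T := T₂) (D.finite_critical.image fun s : ℝ => s + (ε : ℝ) / 2)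
  refine ((h₁.image D.mk₁).union
    ((h₂.preimage Subtype.val_injective.injOn).image D.mk₂)).subset fun x hx => ?_
  induction x using mean_induction with
  | h₁ p => exact .inl ⟨p, ⟨_, hx, add_sub_cancel_right _ _⟩, rfl⟩
  | h₂ w hw => exact .inr ⟨w, ⟨_, hx, sub_add_cancel _ _⟩, rfl⟩

/-- The heights of vertices are critical, so the point can be lowered along its edge to the greatest
critical height. In a subtree the cutting height is critical too, so lowering never leaves the
trimmed part; the root stays the same because the image of `α` is an up-set. -/
theorem exists_floor (x : D.Mean) : ∃ y, D.k y ∈ D.critical ∧ D.raise y (D.k x) = x ∧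
    ∀ s ∈ D.critical, s ≤ D.k x → s ≤ D.k y := by
  induction x using mean_induction with
  | h₁ p =>
    have hp : T₁.height p.vertex + ε / 2 ≤ D.k (D.mk₁ p) := by
      rw [k_mk₁]; linarith [p.le_level]
    obtain ⟨m, hm, hmp, hmax⟩ :=
      D.finite_critical.exists_greatest_le (D.height₁_mem_critical p.vertex) hp
    have h := hmax _ (D.height₁_mem_critical p.vertex) hp
    rw [k_mk₁] at hmp
    have hk : D.k (D.mk₁ (p.lower (m - ε / 2) (by linarith) (by linarith))) = m := by
      rw [k_mk₁]; exact sub_add_cancel _ _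
    refine ⟨_, hk.symm ▸ hm, ?_, hk.symm ▸ hmax⟩
    rw [raise_mk₁, k_mk₁, add_sub_cancel_right, Pt.raise_level_eq (p.lower_le _ _ _)]
  | h₂ w hw =>
    obtain ⟨hr, hwl⟩ := D.mem_trimmed_iff.mp w.2
    have hwr := (D.le_root w.1).2
    have hw2 : T₂.height w.1.vertex - ε / 2 ≤ D.k (D.mk₂ w) := by
      rw [k_mk₂]; linarith [w.1.le_level]
    have hw3 : (D.root w.1).level - ε - ε / 2 ≤ D.k (D.mk₂ w) := by
      rw [k_mk₂]; linarith
    obtain ⟨m, hm, hmw, hmax⟩ :=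
      D.finite_critical.exists_greatest_le (D.height₂_mem_critical w.1.vertex) hw2
    have h2 := hmax _ (D.height₂_mem_critical w.1.vertex) hw2
    have h3 := hmax _ (D.root_sub_mem_critical hr) hw3
    rw [k_mk₂] at hmw
    set z : T₂.Pt := w.1.lower (m + ε / 2) (by linarith) (by linarith)
    have hzl : z.level = m + ε / 2 := rfl
    have hzw : z ≤ w.1 := w.1.lower_le _ _ _
    have hzr : D.root w.1 = D.root z := by
      refine D.root_eq_of_le hzw ?_
      rcases Pt.le_total_of_le (D.le_root z) hzw with h | h
      · exact absurd (D.isUpperSet_range_α h (D.root_mem_range z)) hw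
      · exact h
    have hzt : z ∈ D.trimmed := by
      rw [mem_trimmed_iff, ← hzr]
      exact ⟨hr, by linarith⟩
    have hk : D.k (D.mk₂ ⟨z, hzt⟩) = m := by
      rw [k_mk₂]; exact add_sub_cancel_right _ _
    refine ⟨_, hk.symm ▸ hm, ?_, hk.symm ▸ hmax⟩
    rw [k_mk₂, D.raise_mk₂_of_le (by
      dsimp only
      rw [← hzr]
      linarith)]
    congr 1
    refine Subtype.ext ?_
    dsimp only
    rw [sub_add_cancel, Pt.raise_level_eq hzw]

variable {D} in
-- The starting height of a merge is critical, so a merge in force at height `t` is already in force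
-- at `s`. The path from `u₂` is the only one reaching `p₂` from height `s`, and it is merged there
-- with the path from `u₁`.
theorem merge_descends {s t : ℝ} (hst : ∀ r ∈ D.critical, r ≤ t → r ≤ s) {p₁ p₂ u₁ u₂ : T₁.Pt}
    (hu₁ : u₁ ∈ augmentedVertices T₁ T₂ ε) (hu₂ : u₂ ∈ augmentedVertices T₁ T₂ ε)
    (hα : D.α u₁ = D.α u₂) (h₁ : u₁ ≤ p₁) (h₂ : u₂ ≤ p₂) (hp : p₁.level = p₂.level)
    (hε : u₁.level + ε ≤ p₁.level) (ht : p₁.level + ε / 2 = t) {x : D.Mean}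
    (hx : ∀ u ≤ p₁, u.level + ε / 2 = s → D.mk₁ u = x) (q : T₁.Pt) (hq : q ≤ p₂)
    (hqs : q.level + ε / 2 = s) : D.mk₁ q = x := by
  have hl : u₁.level = u₂.level := by
    have := congrArg Pt.level hα
    rw [D.good.level, D.good.level] at this
    linarith
  have h3 := hst _ (D.augmented_mem_critical hu₁) (by linarith)
  have hε0 := ε.coe_nonneg
  have hq2 := hq.2
  have hr1 : (u₁.raise q.level).level = q.level := Pt.raise_level_of_le (by
    linarith)
  have hr2 : (u₂.raise q.level).level = q.level := Pt.raise_level_of_le (by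
    linarith)
  have hqu : u₂.raise q.level = q := by
    refine Pt.eq_of_le_of_forall_notMem (Pt.raise_le h₂ hq2) hq hr2 fun v hv => ?_
    rw [hr2] at hv
    have := hst _ (D.height₁_mem_critical v) (by linarith [hv.2])
    linarith [hv.1]
  rw [← hx (u₁.raise q.level) (Pt.raise_le h₁ (by linarith)) (by rw [hr1, hqs]), ← hqu]
  refine (Quot.sound (.merge u₁ u₂ _ _ hu₁ hu₂ hα (u₁.le_raise _) (u₂.le_raise _) ?_ ?_)).symm
  · rw [hqu, hr1]
  · rw [hqu, hr1]; linarith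

/-- The point `z` at height `t` has no descendant at height `s` other than `x`, as far as this can
be seen from a given representative of `z`. -/
def OnlyDescendant (s : ℝ) (x : D.Mean) : T₁.Pt ⊕ D.trimmed → Prop :=
  Sum.elim (fun p => ∀ u ≤ p, u.level + ε / 2 = s → D.mk₁ u = x)
    fun w => ∀ w' : D.trimmed, w'.1 ≤ w.1 → w'.1.level - ε / 2 = s → D.mk₂ w' = x

variable {D} in
theorem onlyDescendant_iff_of_glue {s t : ℝ} (hlt : s < t)
    (hst : ∀ r ∈ D.critical, r ≤ t → r ≤ s) (x : D.Mean) {a b : T₁.Pt ⊕ D.trimmed}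
    (h : D.Glue a b) (ht : D.k (Quot.mk _ a) = t) :
    D.OnlyDescendant s x a ↔ D.OnlyDescendant s x b := by
  rcases h with ⟨a, ha⟩ | ⟨u₁, u₂, p₁, p₂, hu₁, hu₂, hα, h₁, h₂, hp, hε⟩
  · have hk : D.k (D.mk₁ (D.attach a)) = t := ht
    rw [D.mk₁_attach ha, k_mk₂] at hk
    exact absurd (hst _ (D.root_mem_critical ha) hk.le) (by rw [← hk] at hlt; exact hlt.not_ge)
  · have hk : p₁.level + ε / 2 = t := ht
    have hl : u₁.level = u₂.level := by
      have := congrArg Pt.level hα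
      rw [D.good.level, D.good.level] at this
      linarith
    exact ⟨fun hx => merge_descends hst hu₁ hu₂ hα h₁ h₂ hp hε hk hx,
      fun hx => merge_descends hst hu₂ hu₁ hα.symm h₂ h₁ hp.symm (by rwa [← hl, ← hp])
        (by rwa [← hp]) hx⟩

variable {D} in
-- Equality in the quotient may come from a chain of gluings, so an invariant is carried along:
-- having no descendant at the height of `x` other than `x`. It holds for the chosen representative
-- of `raise x t` since neither tree branches in between, it respects each gluing, and the
-- representative of `raise y t` has `y` below it.
theorem eq_of_raise_eq (x y : D.Mean) (t : ℝ) (hxy : D.k x = D.k y)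
    (h : D.raise x t = D.raise y t) (hst : ∀ s ∈ D.critical, s ≤ t → s ≤ D.k x) : x = y := by
  rcases le_or_gt t (D.k x) with hle | hlt
  · rwa [D.raise_of_le x t hle, D.raise_of_le y t (hxy ▸ hle)] at h
  have hwd : ∀ a b : T₁.Pt ⊕ D.trimmed, D.Glue a b →
      (D.k (Quot.mk _ a) = t → D.OnlyDescendant (D.k x) x a) =
      (D.k (Quot.mk _ b) = t → D.OnlyDescendant (D.k x) x b) := fun a b hab => by
    have hq : (Quot.mk D.Glue a : D.Mean) = Quot.mk D.Glue b := Quot.sound hab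
    rw [← hq]
    exact propext (forall_congr' fun ht => onlyDescendant_iff_of_glue hlt hst x hab ht)
  let P : D.Mean → Prop :=
    Quot.lift (fun a => D.k (Quot.mk _ a) = t → D.OnlyDescendant (D.k x) x a) hwd
  -- Heights of roots are critical, so the climb to `t` ends strictly below the root and stays
  -- inside one subtree.
  have hroot : ∀ w : D.trimmed, w.1 ∉ Set.range D.α → D.k (D.mk₂ w) = D.k x →
      t + ε / 2 < (D.root w.1).level := fun w hw hk => by
    by_contra! hge
    have h1 := hst _ (D.root_mem_critical (D.mem_trimmed_iff.mp w.2).1) (by linarith)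
    rw [← hk, k_mk₂] at h1
    linarith [D.level_lt_level_root hw]
  have hx : P (D.raise x t) := by
    induction x using mean_induction with
    | h₁ p =>
      intro _ u hu hul
      rw [k_mk₁] at hul hlt
      refine congrArg D.mk₁ (Pt.eq_of_le_of_forall_notMem hu (p.le_raise _) (by linarith) ?_)
      intro v hv
      rw [Pt.raise_level_of_le (by linarith)] at hv
      have := hst _ (D.height₁_mem_critical v) (by linarith [hv.2])
      rw [k_mk₁] at this
      linarith [hv.1]
    | h₂ w hw =>
      rw [D.raise_mk₂_of_lt (hroot w hw rfl)]
      intro _ w' hw' hwl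
      rw [k_mk₂] at hwl hlt
      refine congrArg D.mk₂ (Subtype.ext (Pt.eq_of_le_of_forall_notMem hw' (w.1.le_raise _)
        (by linarith) ?_))
      intro v hv
      dsimp only at hv
      rw [Pt.raise_level_of_le (by linarith)] at hv
      have := hst _ (D.height₂_mem_critical v) (by linarith [hv.2])
      rw [k_mk₂] at this
      linarith [hv.1]
  have hkt : D.k (D.raise y t) = t := by rw [k_raise, ← hxy, max_eq_left hlt.le]
  rw [h] at hx
  induction y using mean_induction with
  | h₁ q => exact (hx hkt q (q.le_raise _) hxy.symm).symm
  | h₂ w hw =>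
    rw [D.raise_mk₂_of_lt (hroot w hw hxy.symm)] at hx hkt
    exact (hx hkt w (w.1.le_raise _) hxy.symm).symm

/-- The mean tree, described by its points. -/
noncomputable def levelledTree : LevelledTree D.Mean where
  level := D.k
  raise := D.raise
  level_raise := D.k_raise
  raise_raise := D.raise_raise
  raise_of_le := D.raise_of_le
  exists_raise_eq := D.exists_raise_eq
  critical := D.critical
  finite_vertices := D.finite_k_mem_critical
  exists_floor := D.exists_floor
  eq_of_raise_eq := eq_of_raise_eq
  nonempty := ⟨D.mk₁ (Pt.ofVertex ⊥)⟩

/-! ### The quotient topology agrees with the tree topology -/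

theorem level_equivPt (x : D.Mean) : (D.levelledTree.equivPt x).level = D.k x := rfl

theorem monotone_equivPt_mk₁ : Monotone fun p => D.levelledTree.equivPt (D.mk₁ p) :=
  LevelledTree.monotone_equivPt_comp _ (c := ε / 2) fun p t => by
    change D.mk₁ (p.raise t) = D.raise (D.mk₁ p) (t + ε / 2)
    rw [raise_mk₁, add_sub_cancel_right]

variable {D} in
theorem equivPt_mk₂_le {w w' : D.trimmed} (h : w.1 ≤ w'.1) (hr : D.root w.1 = D.root w'.1) :
    D.levelledTree.equivPt (D.mk₂ w) ≤ D.levelledTree.equivPt (D.mk₂ w') := by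
  have : D.raise (D.mk₂ w) (w'.1.level - ε / 2) = D.mk₂ w' := by
    rw [D.raise_mk₂_of_le (by rw [sub_add_cancel, hr]; exact (D.le_root _).2)]
    congr 1
    refine Subtype.ext ?_
    dsimp only
    rw [sub_add_cancel, Pt.raise_level_eq h]
  rw [← this]
  exact D.levelledTree.le_equivPt_raise _ _

/-- Sufficiently close points of the trimmed subtrees lie in the same subtree. -/
theorem exists_root_eq (z : D.trimmed) : ∃ r > 0, ∀ z' : D.trimmed, dist z.1 z'.1 < r →
    (z.1 ≤ z'.1 ∨ z'.1 ≤ z.1) ∧ D.root z.1 = D.root z'.1 := by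
  obtain ⟨r₁, hr₁, hcomp⟩ := Pt.exists_comparable z.1
  obtain ⟨r₂, hr₂, hgap⟩ := exists_pos_forall_notMem_Ioc
    (D.finite_roots.image fun a => |z.1.level - a.level|)
  have key : ∀ z' : D.trimmed, dist z.1 z'.1 < r₂ → ∀ a ∈ D.roots, a.level ≠ z.1.level →
      |z.1.level - a.level| ≤ |z.1.level - z'.1.level| → False := fun z' hz' a ha hne hle =>
    hgap _ ⟨a, ha, rfl⟩ ⟨abs_pos.mpr (sub_ne_zero.mpr hne.symm),
      hle.trans ((Pt.abs_level_sub_le_dist _ _).trans hz'.le)⟩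
  refine ⟨min r₁ r₂, lt_min hr₁ hr₂, fun z' hz' => ?_⟩
  have hc := hcomp z'.1 (hz'.trans_le (min_le_left _ _))
  have hkey := key z' (hz'.trans_le (min_le_right _ _))
  refine ⟨hc, ?_⟩
  obtain ⟨hz, -⟩ := D.mem_trimmed_iff.mp z.2
  obtain ⟨hz'', -⟩ := D.mem_trimmed_iff.mp z'.2
  rcases hc with h | h
  · rcases Pt.le_total_of_le h (D.le_root z.1) with h1 | h1
    · exact (D.root_eq_of_le h h1).symm
    · have hm := D.isUpperSet_range_α h1 (D.root_mem_range _)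
      rw [D.root_of_mem hm] at hz'' ⊢
      by_cases he : z'.1.level = z.1.level
      · rw [← Pt.eq_of_le_of_le le_rfl h he.symm] at hm ⊢
        exact D.root_of_mem hm
      · exact (hkey _ hz'' he le_rfl).elim
  · rcases Pt.le_total_of_le h (D.le_root z'.1) with h1 | h1
    · exact D.root_eq_of_le h h1
    · by_cases he : (D.root z'.1).level = z.1.level
      · exact D.root_eq_of_le h (Pt.eq_of_le_of_le h1 le_rfl he.symm).le
      · refine (hkey _ hz'' he ?_).elim
        have h2 := h1.2
        have h3 := (D.le_root z'.1).2
        rw [abs_of_nonneg (by linarith), abs_of_nonneg (by linarith)]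
        linarith

/-- Near a given point only its own subtree is seen, and there comparable points keep their height
difference. -/
theorem continuous_equivPt_mk₂ : Continuous fun w => D.levelledTree.equivPt (D.mk₂ w) := by
  refine continuous_iff_continuousAt.mpr fun z => Metric.continuousAt_iff.mpr fun δ hδ => ?_
  obtain ⟨r, hr, hroot⟩ := D.exists_root_eq z
  refine ⟨min r δ, lt_min hr hδ, fun z' hz' => ?_⟩
  have hd : dist z.1 z'.1 < min r δ := by rw [dist_comm]; exact hz'
  have hdδ := hd.trans_le (min_le_right _ _)
  obtain ⟨hc, he⟩ := hroot z' (hd.trans_le (min_le_left _ _))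
  rw [dist_comm]
  rcases hc with h | h
  · rw [Pt.dist_of_le h] at hdδ
    rw [Pt.dist_of_le (equivPt_mk₂_le h he), level_equivPt, level_equivPt, k_mk₂, k_mk₂]
    linarith
  · rw [dist_comm, Pt.dist_of_le h] at hdδ
    rw [dist_comm, Pt.dist_of_le (equivPt_mk₂_le h he.symm), level_equivPt, level_equivPt, k_mk₂,
      k_mk₂]
    linarith

theorem continuous_equivPt : Continuous D.levelledTree.equivPt := by
  have h : Continuous fun a : T₁.Pt ⊕ D.trimmed => D.levelledTree.equivPt (Quot.mk _ a) :=
    continuous_sum_dom.mpr ⟨Pt.continuous_of_monotone D.monotone_equivPt_mk₁ (c := ε / 2)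
      fun p => rfl, D.continuous_equivPt_mk₂⟩
  exact isQuotientMap_quot_mk.continuous_iff.mpr h

/-- The mean tree is homeomorphic to the underlying space of a merge tree. -/
noncomputable def homeomorphPt : D.Mean ≃ₜ D.levelledTree.toMergeTree.Pt where
  toEquiv := D.levelledTree.equivPt
  continuous_toFun := D.continuous_equivPt
  continuous_invFun := D.levelledTree.continuous_equivPt_symm D.continuous_raise

end MeanTreeData

end MergeTree

/-! ### The four half-shifts and the distance bounds -/

namespace MergeTree

namespace MeanTreeData

variable {T₁ T₂ : MergeTree.{u}} {ε : ℝ≥0} (D : MeanTreeData T₁ T₂ ε)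

/-- The map from the mean tree to `T₁` that shifts heights by `ε / 2`. -/
noncomputable def toLeft : D.Mean → T₁.Pt :=
  Quot.lift (Sum.elim (fun p => p.raise (p.level + ε))
    fun w => (D.attach (D.root w.1)).raise w.1.level) (by
    rintro _ _ (⟨a, ha⟩ | ⟨u₁, u₂, p₁, p₂, -, -, hα, h₁, h₂, hp, hε⟩)
    · simp only [Sum.elim_inl, Sum.elim_inr, D.root_of_mem (D.roots_subset_range ha),
        D.attach_level ha, sub_add_cancel]
    -- Goodness, used in both directions, gives `u₁^{2ε} = u₂^{2ε}`. As `pᵢ` lies at least `ε` above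
    -- `uᵢ`, climbing another `ε` reaches an ancestor of this common point.
    · have h₁' := D.good.le_of_le u₁ u₂ hα.le
      have h₂' := D.good.le_of_le u₂ u₁ hα.ge
      have hu := le_antisymm h₁' h₂'
      have hle : ∀ {u p : T₁.Pt}, u ≤ p → u.level + ε ≤ p.level →
          u.up (2 * ε) ≤ p.raise (p.level + ε) := fun {u p} hu hl =>
        Pt.le_of_le_of_le (u.le_up _) (hu.trans (p.le_raise _)) (by
          rw [Pt.up_level, Pt.raise_level_of_le (le_add_of_nonneg_right ε.coe_nonneg)]
          push_cast
          linarith)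
      have hl : u₁.level = u₂.level := by
        have := congrArg Pt.level hα
        rw [D.good.level, D.good.level] at this
        linarith
      refine Pt.eq_of_le_of_le (hle h₁ hε) (hu ▸ hle h₂ (by rwa [← hl, ← hp])) ?_
      change (p₁.raise _).level = (p₂.raise _).level
      rw [Pt.raise_level, Pt.raise_level, hp])

theorem toLeft_mk₁ (p : T₁.Pt) : D.toLeft (D.mk₁ p) = p.raise (p.level + ε) := rfl

theorem toLeft_mk₂ (w : D.trimmed) :
    D.toLeft (D.mk₂ w) = (D.attach (D.root w.1)).raise w.1.level := rfl

/-- The map from the mean tree to `T₂` that shifts heights by `ε / 2`. -/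
def toRight : D.Mean → T₂.Pt :=
  Quot.lift (Sum.elim D.α fun w => w.1) (by
    rintro _ _ (⟨a, ha⟩ | ⟨u₁, u₂, p₁, p₂, -, -, hα, h₁, h₂, hp, -⟩)
    · exact D.α_attach_root ha
    · exact Pt.eq_of_le_of_le (D.monotone_α h₁) (hα ▸ D.monotone_α h₂)
        ((D.good.level p₁).trans (hp ▸ (D.good.level p₂).symm)))

theorem toRight_mk₁ (p : T₁.Pt) : D.toRight (D.mk₁ p) = D.α p := rfl

theorem toRight_mk₂ (w : D.trimmed) : D.toRight (D.mk₂ w) = w.1 := rfl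

theorem toLeft_level (x : D.Mean) : (D.toLeft x).level = D.k x + ε / 2 := by
  induction x using mean_induction with
  | h₁ p =>
    rw [toLeft_mk₁, k_mk₁, Pt.raise_level_of_le (le_add_of_nonneg_right ε.coe_nonneg)]
    ring
  | h₂ w hw =>
    obtain ⟨hr, hl⟩ := D.mem_trimmed_iff.mp w.2
    rw [toLeft_mk₂, k_mk₂, Pt.raise_level_of_le (by rwa [D.attach_level hr]), sub_add_cancel]

theorem toRight_level (x : D.Mean) : (D.toRight x).level = D.k x + ε / 2 := by
  induction x using mean_induction with
  | h₁ p => rw [toRight_mk₁, k_mk₁, D.good.level]; ring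
  | h₂ w hw => rw [toRight_mk₂, k_mk₂, sub_add_cancel]

theorem toLeft_raise (x : D.Mean) (t : ℝ) :
    D.toLeft (D.raise x t) = (D.toLeft x).raise (t + ε / 2) := by
  have hl : (D.toLeft (D.raise x t)).level = ((D.toLeft x).raise (t + ε / 2)).level := by
    rw [toLeft_level, k_raise, Pt.raise_level, toLeft_level, max_add_add_right]
  induction x using mean_induction with
  | h₁ p =>
    exact Pt.eq_of_le_of_le (x := p) ((p.le_raise _).trans (Pt.le_raise _ _))
      ((p.le_raise _).trans (Pt.le_raise _ _)) hl
  | h₂ w hw =>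
    refine Pt.eq_of_le_of_le (x := D.attach (D.root w.1)) ?_
      ((Pt.le_raise _ _).trans (Pt.le_raise _ _)) hl
    rcases le_or_gt (D.root w.1).level (t + ε / 2) with h | h
    · rw [D.raise_mk₂_of_ge h, toLeft_mk₁]
      exact (Pt.le_raise _ _).trans (Pt.le_raise _ _)
    · rw [D.raise_mk₂_of_lt h, toLeft_mk₂, D.root_raise h.le]
      exact Pt.le_raise _ _

theorem toRight_raise (x : D.Mean) (t : ℝ) :
    D.toRight (D.raise x t) = (D.toRight x).raise (t + ε / 2) := by
  have hl : (D.toRight (D.raise x t)).level = ((D.toRight x).raise (t + ε / 2)).level := by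
    rw [toRight_level, k_raise, Pt.raise_level, toRight_level, max_add_add_right]
  refine Pt.eq_of_le_of_le (x := D.toRight x) ?_ (Pt.le_raise _ _) hl
  induction x using mean_induction with
  | h₁ p => exact D.monotone_α (p.le_raise _)
  | h₂ w hw =>
    rcases le_or_gt (D.root w.1).level (t + ε / 2) with h | h
    · rw [D.raise_mk₂_of_ge h, toRight_mk₁, toRight_mk₂]
      refine (D.le_root w.1).trans (le_of_eq_of_le ?_ (D.monotone_α (Pt.le_raise _ _)))
      exact (D.α_attach_root (D.mem_trimmed_iff.mp w.2).1).symm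
    · rw [D.raise_mk₂_of_lt h, toRight_mk₂, toRight_mk₂]
      exact w.1.le_raise _

theorem mk₁_toLeft (x : D.Mean) : D.mk₁ (D.toLeft x) = D.raise x (D.k x + ε) := by
  induction x using mean_induction with
  | h₁ p =>
    rw [toLeft_mk₁, raise_mk₁, k_mk₁]
    congr 2
    ring
  | h₂ w hw =>
    have hl := (D.mem_trimmed_iff.mp w.2).2
    rw [toLeft_mk₂, k_mk₂, D.raise_mk₂_of_ge (by linarith)]
    congr 2
    ring

theorem raise_sub_mem_trimmed {w : T₂.Pt} (hw : w ∉ Set.range D.α) :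
    w.raise ((D.root w).level - ε) ∈ D.trimmed := by
  rw [mem_trimmed_iff, D.root_raise (sub_le_self _ ε.coe_nonneg), Pt.raise_level]
  exact ⟨D.root_mem_roots hw, le_max_left _ _⟩

open Classical in
/-- A point of the mean tree that corresponds to `w` or to the lowest ancestor of `w` that has not
been trimmed off. -/
noncomputable def lift (w : T₂.Pt) : D.Mean :=
  if h : w ∈ Set.range D.α then D.mk₁ h.choose else D.mk₂ ⟨_, D.raise_sub_mem_trimmed h⟩

theorem exists_lift_eq {w : T₂.Pt} (h : w ∈ Set.range D.α) :
    ∃ c, D.α c = w ∧ D.lift w = D.mk₁ c := ⟨h.choose, h.choose_spec, dif_pos h⟩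

theorem lift_of_notMem {w : T₂.Pt} (h : w ∉ Set.range D.α) :
    D.lift w = D.mk₂ ⟨_, D.raise_sub_mem_trimmed h⟩ := dif_neg h

/-- The map from `T₂` to the mean tree that shifts heights by `ε / 2`. -/
noncomputable def ofRight (w : T₂.Pt) : D.Mean := D.raise (D.lift w) (w.level + ε / 2)

/-- Outside the image the lift has height `max (g w) (g(w^A) - ε) - ε / 2`, and the bound `g(w^A) ≤
g w + 2ε` is exactly what is needed. So `ofRight` really climbs to the intended height. -/
theorem k_lift_le (w : T₂.Pt) : D.k (D.lift w) ≤ w.level + ε / 2 := by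
  have hε : (0 : ℝ) ≤ ε := ε.coe_nonneg
  by_cases h : w ∈ Set.range D.α
  · obtain ⟨c, rfl, hc⟩ := D.exists_lift_eq h
    rw [hc, k_mk₁, D.good.level]
    linarith
  · have := D.level_root_le w
    rw [D.lift_of_notMem h, k_mk₂, Pt.raise_level, sub_le_iff_le_add, max_le_iff]
    constructor <;> linarith

theorem k_ofRight (w : T₂.Pt) : D.k (D.ofRight w) = w.level + ε / 2 := by
  rw [ofRight, k_raise, max_eq_left (D.k_lift_le w)]

variable {D} in
-- The point `c'` and the ancestor of `c` at its height have the same image, so their paths are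
-- merged from `ε` higher on, which is the height of `α c'`.
theorem mk₁_raise_level_eq {c c' : T₁.Pt} (h : D.α c ≤ D.α c') :
    D.mk₁ (c'.raise (D.α c').level) = D.mk₁ (c.raise (D.α c').level) := by
  have hε : (0 : ℝ) ≤ ε := ε.coe_nonneg
  have h1 : D.α c' = D.α (c.raise ((D.α c').level - ε)) := by
    rw [α_raise, sub_add_cancel, Pt.raise_level_eq h]
  rw [mk₁_raise_eq h1 (D.good.level c').ge, Pt.raise_raise, max_eq_right (by linarith)]

/-- Lifts depend on arbitrary preimages and need not be monotone; after the climb the dependence is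
gone. This is what makes `ofRight` commute with taking ancestors. -/
theorem raise_lift_eq {w w' : T₂.Pt} (h : w ≤ w') :
    D.raise (D.lift w') (w'.level + ε / 2) = D.raise (D.lift w) (w'.level + ε / 2) := by
  have hε : (0 : ℝ) ≤ ε := ε.coe_nonneg
  by_cases hw' : w' ∈ Set.range D.α
  · obtain ⟨c', rfl, hc'⟩ := D.exists_lift_eq hw'
    rw [hc', raise_mk₁, add_sub_cancel_right]
    by_cases hw : w ∈ Set.range D.α
    · obtain ⟨c, rfl, hc⟩ := D.exists_lift_eq hw
      rw [hc, raise_mk₁, add_sub_cancel_right, mk₁_raise_level_eq h]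
    · have hr := D.root_le hw' h
      have hr' := D.root_raise (w := w) (sub_le_self (D.root w).level hε)
      rw [D.lift_of_notMem hw, D.raise_mk₂_of_ge (by
        dsimp only
        rw [hr']
        linarith [hr.2])]
      dsimp only
      rw [hr', add_sub_cancel_right]
      refine mk₁_raise_level_eq ?_
      rwa [D.α_attach_root (D.root_mem_roots hw)]
  · have hw : w ∉ Set.range D.α := fun hw => hw' (D.isUpperSet_range_α h hw)
    have hw'r : w' ≤ D.root w := (Pt.le_total_of_le h (D.le_root w)).resolve_right
      fun h' => hw' (D.isUpperSet_range_α h' (D.root_mem_range w))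
    have hr := D.root_eq_of_le h hw'r
    have hr' := D.root_raise (w := w) (sub_le_self (D.root w).level hε)
    set s := max w'.level ((D.root w).level - ε)
    have hsr : s ≤ (D.root w).level := max_le hw'r.2 (sub_le_self _ hε)
    -- Both points hang below the same root, so their lowest untrimmed ancestors lie on one path.
    have hlift : D.lift w' = D.raise (D.lift w) (s - ε / 2) := by
      rw [D.lift_of_notMem hw', D.lift_of_notMem hw, D.raise_mk₂_of_le (by
        dsimp only
        rwa [hr', sub_add_cancel])]
      congr 1
      refine Subtype.ext ?_
      dsimp only
      rw [hr, sub_add_cancel, Pt.raise_raise, max_eq_right (le_max_right _ _),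
        ← Pt.raise_raise, Pt.raise_level_eq h]
    have hb := D.level_root_le w'
    rw [hr] at hb
    rw [hlift, raise_raise, max_eq_right]
    rw [sub_le_iff_le_add, max_le_iff]
    constructor <;> linarith

theorem ofRight_raise (w : T₂.Pt) (t : ℝ) :
    D.ofRight (w.raise t) = D.raise (D.ofRight w) (t + ε / 2) := by
  rw [ofRight, ofRight, raise_raise, max_add_add_right, max_comm, ← Pt.raise_level]
  exact D.raise_lift_eq (w.le_raise t)

/-- The preimage chosen for `α p` may differ from `p`, but the two are merged at the height reached.
A trimmed point is its own lift. -/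
theorem ofRight_toRight (x : D.Mean) : D.ofRight (D.toRight x) = D.raise x (D.k x + ε) := by
  induction x using mean_induction with
  | h₁ p =>
    obtain ⟨c, hc, hl⟩ := D.exists_lift_eq (Set.mem_range_self p)
    rw [toRight_mk₁, ofRight, hl, raise_mk₁, raise_mk₁, k_mk₁, add_sub_cancel_right,
      mk₁_raise_eq hc (by rw [← hc, D.good.level]), D.good.level]
    congr 2
    ring
  | h₂ w hw =>
    have hl := (D.mem_trimmed_iff.mp w.2).2
    have : D.lift w.1 = D.mk₂ w := by
      rw [D.lift_of_notMem hw]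
      exact congrArg D.mk₂ (Subtype.ext (Pt.raise_of_le hl))
    rw [toRight_mk₂, ofRight, this, k_mk₂]
    congr 1
    ring

theorem le_toRight_ofRight (w : T₂.Pt) : w ≤ D.toRight (D.ofRight w) := by
  rw [ofRight, toRight_raise]
  refine le_trans ?_ (Pt.le_raise _ _)
  by_cases h : w ∈ Set.range D.α
  · obtain ⟨c, hc, hl⟩ := D.exists_lift_eq h
    rw [hl, toRight_mk₁, hc]
  · rw [D.lift_of_notMem h]
    exact w.le_raise _

theorem interleavingDist_left_le :
    T₁.interleavingDist D.levelledTree.toMergeTree ≤ (ε / 2 : ℝ≥0) := by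
  refine interleavingDist_le_of_monotone D.monotone_equivPt_mk₁
    (D.levelledTree.monotone_comp_equivPt_symm D.toLeft_raise) (fun u => ?_) (fun x => ?_)
    (fun u => ?_) fun x => ?_
  · rw [level_equivPt, k_mk₁, NNReal.coe_div, NNReal.coe_two]
  · rw [toLeft_level, NNReal.coe_div, NNReal.coe_two]
    exact congrArg (· + (ε / 2 : ℝ)) (D.levelledTree.level_equivPt_symm x)
  · rw [Equiv.symm_apply_apply, toLeft_mk₁]
    exact u.le_raise _
  · rw [mk₁_toLeft]
    exact (D.levelledTree.equivPt.apply_symm_apply x).ge.trans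
      (D.levelledTree.le_equivPt_raise _ _)

theorem interleavingDist_right_le :
    T₂.interleavingDist D.levelledTree.toMergeTree ≤ (ε / 2 : ℝ≥0) := by
  refine interleavingDist_le_of_monotone
    (D.levelledTree.monotone_equivPt_comp D.ofRight_raise)
    (D.levelledTree.monotone_comp_equivPt_symm D.toRight_raise) (fun u => ?_) (fun x => ?_)
    (fun u => ?_) fun x => ?_
  · rw [level_equivPt, k_ofRight, NNReal.coe_div, NNReal.coe_two]
  · rw [toRight_level, NNReal.coe_div, NNReal.coe_two]
    exact congrArg (· + (ε / 2 : ℝ)) (D.levelledTree.level_equivPt_symm x)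
  · rw [Equiv.symm_apply_apply]
    exact D.le_toRight_ofRight u
  · rw [ofRight_toRight]
    exact (D.levelledTree.equivPt.apply_symm_apply x).ge.trans
      (D.levelledTree.le_equivPt_raise _ _)

end MeanTreeData

end MergeTree

theorem theorem4 (T₁ T₂ : MergeTree.{u}) (ε : ℝ≥0) (hε : T₁.interleavingDist T₂ ≤ ε) :
    -- the construction can be carried out
    Nonempty (MergeTree.MeanTreeData T₁ T₂ ε) ∧
    -- however it is carried out, its result is a merge tree `T₃` with the asserted distances
    ∀ D : MergeTree.MeanTreeData T₁ T₂ ε,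
      ∃ (T₃ : MergeTree.{u}) (φ : D.Mean ≃ₜ T₃.Pt), (∀ x, (φ x).level = D.k x) ∧
        T₁.interleavingDist T₃ ≤ (ε / 2 : ℝ≥0) ∧ T₂.interleavingDist T₃ ≤ (ε / 2 : ℝ≥0) := by
  exact ⟨MergeTree.nonempty_meanTreeData hε, fun D => ⟨D.levelledTree.toMergeTree, D.homeomorphPt,
    D.level_equivPt, D.interleavingDist_left_le, D.interleavingDist_right_le⟩⟩
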